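/- Let $\Bbbk$ be a field and $B$ a $\Bbbk$-bialgebra satisfying the twisting conditions: (T1) $B=\bigoplus_{n\in\mathbb Z}B_n$ is $\mathbb Z$-graded as an algebra, and (T2) $\Delta(B_n)\subseteq B_n\otimes B_n$ for all $n$. A \emph{twisting pair} of a bialgebra is a pair $(\phi_1,\phi_2)$ of algebra automorphisms with $\Delta\phi_1=(\mathrm{id}\otimes\phi_1)\Delta$, $\Delta\phi_2=(\phi_2\otimes\mathrm{id})\Delta$ and $\varepsilon\phi_1\phi_2=\varepsilon$. Let $i:B\to\mathcal H(B)$ be the Hopf envelope of $B$ (the universal bialgebra map from $B$ to a Hopf algebra). Let $(\phi_1,\phi_2)$ be a twisting pair of $B$. Then: (1) There is a unique twisting pair $(\mathcal H(\phi_1),\mathcal H(\phi_2))$ of $\mathcal H(B)$ extending $(\phi_1,\phi_2)$, i.e. with $\mathcal H(\phi_j)\circ i=i\circ\phi_j$ for $j=1,2$. (2) $\mathcal H(B)$ has a unique $\mathbb Z$-grading satisfying (T1)–(T2) with $i(B_n)\subseteq\mathcal H(B)_n$ for all $n$. There is a unique Hopf algebra automorphism $\mathcal H(\phi_1\circ\phi_2)$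 of $\mathcal H(B)$ with $\mathcal H(\phi_1\circ\phi_2)\circ i=i\circ\phi_1\circ\phi_2$; it equals $\mathcal H(\phi_1)\circ\mathcal H(\phi_2)$ and preserves this grading. (3) The formula $\sigma(x,y)=\varepsilon(x)\,\varepsilon\big(\mathcal H(\phi_2)^{|x|}(y)\big)$, for $x,y\in\mathcal H(B)$ homogeneous and $|x|$ the degree of $x$, defines a 2-cocycle $\sigma$ on $\mathcal H(B)$: it is convolution invertible, $\sum\sigma(x_1,y_1)\sigma(x_2y_2,z)=\sum\sigma(y_1,z_1)\sigma(x,y_2z_2)$ and $\sigma(x,1)=\sigma(1,x)=\varepsilon(x)$ for all $x,y,z$. The 2-cocycle twist $\mathcal H(B)^\sigma$ (the coalgebra $\mathcal H(B)$ with the same unit and the product $x*_\sigma y=\sum\sigma(x_1,y_1)\,x_2y_2\,\sigma^{-1}(x_3,y_3)$) is a Hopf algebra and is equal to the right Zhang twist $\mathcal H(B)^{\mathcal H(\phi_1\circ\phi_2)}$ (the same vector space, unit and coalgebra with the product $x*y=x\,\mathcal H(\phi_1\circ\phi_2)^{|x|}(y)$ for homogeneous $x,y$). -/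

import Mathlib

open scoped TensorProduct

universe u v w

/-- The twisting conditions for a `ℤ`-grading `𝓑` of a bialgebra `B`: it is an algebra grading,
and `Δ(B_n) ⊆ B_n ⊗ B_n` for all `n`. -/
structure TwistingConditions {k B : Type*} [Field k] [Ring B] [Bialgebra k B]
    (𝓑 : ℤ → Submodule k B) : Prop where
  gradedMonoid : SetLike.GradedMonoid 𝓑
  isInternal : DirectSum.IsInternal 𝓑
  comul_mem : ∀ (n : ℤ) (x : B), x ∈ 𝓑 n →
    Coalgebra.comul x ∈ LinearMap.range (TensorProduct.map (𝓑 n).subtype (𝓑 n).subtype)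

/-- Twisting pairs of a bialgebra: algebra automorphisms `φ₁`, `φ₂` with
`Δ ∘ φ₁ = (id ⊗ φ₁) ∘ Δ`, `Δ ∘ φ₂ = (φ₂ ⊗ id) ∘ Δ` and `ε ∘ (φ₁ ∘ φ₂) = ε`. -/
structure IsTwistingPair {k B : Type*} [Field k] [Ring B] [Bialgebra k B]
    (φ₁ φ₂ : B ≃ₐ[k] B) : Prop where
  comul_fst : Coalgebra.comul ∘ₗ φ₁.toLinearMap =
    TensorProduct.map LinearMap.id φ₁.toLinearMap ∘ₗ Coalgebra.comul (R := k) (A := B)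
  comul_snd : Coalgebra.comul ∘ₗ φ₂.toLinearMap =
    TensorProduct.map φ₂.toLinearMap LinearMap.id ∘ₗ Coalgebra.comul (R := k) (A := B)
  counit_comp : ∀ x : B, Coalgebra.counit (R := k) (φ₁ (φ₂ x)) = Coalgebra.counit (R := k) x

/-- `i : B → H` is a Hopf envelope of the bialgebra `B`: every bialgebra map from `B` to a Hopf
algebra `L` factors through `i` by a unique map of Hopf algebras `H → L`. (A map of Hopf algebras
is a bialgebra map; it commutes with the antipodes automatically.) -/
def IsHopfEnvelope {k B H : Type u} [Field k] [Ring B] [Bialgebra k B] [Ring H] [HopfAlgebra k H]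
    (i : B →ₐc[k] H) : Prop :=
  ∀ (L : Type u) [Ring L] [HopfAlgebra k L] (g : B →ₐc[k] L),
    ∃! f : H →ₐc[k] L, f.comp i = g

/-! Every bialgebra has a Hopf envelope: it is the algebra generated by countably many copies of
the vector space `B`, subject to the relations that hold for the maps `S^n ∘ i`. -/

namespace HopfEnvelope
open WithConv
section
variable (k : Type u) (B : Type v) [Field k] [Ring B] [Bialgebra k B]

/-- The vector space `B`, carrying the co-opposite coalgebra structure. -/
def Cop (B : Type v) : Type v := B

instance (B : Type v) [Ring B] : AddCommGroup (Cop B) := inferInstanceAs (AddCommGroup B)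
instance : Module k (Cop B) := inferInstanceAs (Module k B)

/-- The linear map `x ↦ ∑ x₂ ⊗ x₁`. -/
noncomputable def comulCop : B →ₗ[k] B ⊗[k] B :=
  (TensorProduct.comm k B B).toLinearMap ∘ₗ Coalgebra.comul (R := k) (A := B)

/-- The linear map `a ⊗ (b ⊗ c) ↦ c ⊗ (b ⊗ a)`. -/
noncomputable def flip3 : B ⊗[k] (B ⊗[k] B) →ₗ[k] B ⊗[k] (B ⊗[k] B) :=
  (TensorProduct.assoc k B B B).toLinearMap ∘ₗ (TensorProduct.comm k B (B ⊗[k] B)).toLinearMap ∘ₗ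
    TensorProduct.map LinearMap.id (TensorProduct.comm k B B).toLinearMap

theorem comulCop_left :
    (TensorProduct.assoc k B B B).toLinearMap ∘ₗ (comulCop k B).rTensor B ∘ₗ
        (TensorProduct.comm k B B).toLinearMap =
      flip3 k B ∘ₗ (Coalgebra.comul (R := k) (A := B)).lTensor B := by
  ext a b
  simp [comulCop, flip3]

theorem comulCop_right :
    (comulCop k B).lTensor B ∘ₗ (TensorProduct.comm k B B).toLinearMap =
      flip3 k B ∘ₗ (TensorProduct.assoc k B B B).toLinearMap ∘ₗ
        (Coalgebra.comul (R := k) (A := B)).rTensor B := by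
  ext a b
  simp only [comulCop, flip3, TensorProduct.AlgebraTensorModule.curry_apply,
    LinearMap.restrictScalars_self, TensorProduct.curry_apply, LinearMap.comp_apply,
    LinearEquiv.coe_coe, TensorProduct.comm_tmul, LinearMap.lTensor_tmul, LinearMap.rTensor_tmul]
  induction Coalgebra.comul (R := k) a using TensorProduct.induction_on with
  | zero => simp
  | tmul x y => simp
  | add x y hx hy => simp only [map_add, TensorProduct.tmul_add, TensorProduct.add_tmul, hx, hy]

noncomputable instance : Coalgebra k (Cop B) where
  comul := comulCop k B
  counit := Coalgebra.counit (R := k) (A := B)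
  coassoc := by
    have h1 := comulCop_left k B
    have h2 := comulCop_right k B
    have h3 := Coalgebra.coassoc (R := k) (A := B)
    apply LinearMap.ext
    intro x
    have e1 := LinearMap.congr_fun h1 (Coalgebra.comul (R := k) (A := B) x)
    have e2 := LinearMap.congr_fun h2 (Coalgebra.comul (R := k) (A := B) x)
    have e3 := congrArg (flip3 k B) (LinearMap.congr_fun h3 x)
    exact e1.trans (e3.symm.trans e2.symm)
  rTensor_counit_comp_comul := by
    apply LinearMap.ext
    intro x
    have h : (Coalgebra.counit (R := k) (A := B)).rTensor B ∘ₗ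
        (TensorProduct.comm k B B).toLinearMap =
        (TensorProduct.comm k B k).toLinearMap ∘ₗ
          (Coalgebra.counit (R := k) (A := B)).lTensor B := by
      ext; simp
    have e := LinearMap.congr_fun h (Coalgebra.comul (R := k) (A := B) x)
    refine e.trans ?_
    exact (congrArg (TensorProduct.comm k B k) (Coalgebra.lTensor_counit_comul (R := k) (A := B) x))
  lTensor_counit_comp_comul := by
    apply LinearMap.ext
    intro x
    have h : (Coalgebra.counit (R := k) (A := B)).lTensor B ∘ₗ
        (TensorProduct.comm k B B).toLinearMap =
        (TensorProduct.comm k k B).toLinearMap ∘ₗ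
          (Coalgebra.counit (R := k) (A := B)).rTensor B := by
      ext; simp
    have e := LinearMap.congr_fun h (Coalgebra.comul (R := k) (A := B) x)
    refine e.trans ?_
    exact (congrArg (TensorProduct.comm k k B) (Coalgebra.rTensor_counit_comul (R := k) (A := B) x))

variable {A : Type w} [Ring A] [Algebra k A]
variable {k B}

/-- The convolution product `x ↦ ∑ f(x₁) g(x₂)`. -/
noncomputable def conv (f g : B →ₗ[k] A) : B →ₗ[k] A :=
  LinearMap.mul' k A ∘ₗ TensorProduct.map f g ∘ₗ Coalgebra.comul

/-- The opposite convolution product `x ↦ ∑ f(x₂) g(x₁)`. -/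
noncomputable def convCop (f g : B →ₗ[k] A) : B →ₗ[k] A :=
  LinearMap.mul' k A ∘ₗ TensorProduct.map f g ∘ₗ comulCop k B

variable (k B A) in
/-- The unit `x ↦ ε(x) 1` of the convolution products. -/
noncomputable def cone : B →ₗ[k] A := Algebra.linearMap k A ∘ₗ Coalgebra.counit

theorem conv_unique {f g h : B →ₗ[k] A} (h1 : conv g f = cone k B A) (h2 : conv f h = cone k B A) :
    g = h :=
  toConv_injective (left_inv_eq_right_inv (M := WithConv (B →ₗ[k] A)) (a := toConv f)
    (b := toConv g) (c := toConv h) (congrArg toConv h1) (congrArg toConv h2))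

theorem convCop_unique {f g h : B →ₗ[k] A} (h1 : convCop g f = cone k B A)
    (h2 : convCop f h = cone k B A) : g = h :=
  toConv_injective (left_inv_eq_right_inv (M := WithConv (Cop B →ₗ[k] A)) (a := toConv f)
    (b := toConv g) (c := toConv h) (congrArg toConv h1) (congrArg toConv h2))

/-- The relations between the maps `e n = S^{2n} ∘ i` and `o n = S^{2n+1} ∘ i` for a bialgebra map
`i` from `B` to a Hopf algebra with antipode `S`. -/
structure IsFamily (e o : ℕ → B →ₗ[k] A) : Prop where
  e_one : ∀ n, e n 1 = 1
  o_one : ∀ n, o n 1 = 1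
  e_mul : ∀ n x y, e n (x * y) = e n x * e n y
  o_mul : ∀ n x y, o n (x * y) = o n y * o n x
  e_o : ∀ n, conv (e n) (o n) = cone k B A
  o_e : ∀ n, conv (o n) (e n) = cone k B A
  o_e_succ : ∀ n, convCop (o n) (e (n + 1)) = cone k B A
  e_succ_o : ∀ n, convCop (e (n + 1)) (o n) = cone k B A

section
variable {A' : Type*} [Ring A'] [Algebra k A']

theorem comp_mul' (h : A →ₐ[k] A') (f g : B →ₗ[k] A) :
    h.toLinearMap ∘ₗ LinearMap.mul' k A ∘ₗ TensorProduct.map f g =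
      LinearMap.mul' k A' ∘ₗ TensorProduct.map (h.toLinearMap ∘ₗ f) (h.toLinearMap ∘ₗ g) := by
  ext; simp

theorem comp_conv (h : A →ₐ[k] A') (f g : B →ₗ[k] A) : h.toLinearMap ∘ₗ conv f g =
    conv (h.toLinearMap ∘ₗ f) (h.toLinearMap ∘ₗ g) :=
  congrArg (fun F => F ∘ₗ Coalgebra.comul) (comp_mul' h f g)

theorem comp_convCop (h : A →ₐ[k] A') (f g : B →ₗ[k] A) : h.toLinearMap ∘ₗ convCop f g =
    convCop (h.toLinearMap ∘ₗ f) (h.toLinearMap ∘ₗ g) :=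
  congrArg (fun F => F ∘ₗ comulCop k B) (comp_mul' h f g)

theorem comp_cone (h : A →ₐ[k] A') : h.toLinearMap ∘ₗ cone k B A = cone k B A' := by
  ext; simp [cone]

theorem IsFamily.comp {e o : ℕ → B →ₗ[k] A} (he : IsFamily e o) (h : A →ₐ[k] A') :
    IsFamily (fun n => h.toLinearMap ∘ₗ e n) (fun n => h.toLinearMap ∘ₗ o n) where
  e_one n := by simp [he.e_one]
  o_one n := by simp [he.o_one]
  e_mul n x y := by simp [he.e_mul]
  o_mul n x y := by simp [he.o_mul]
  e_o n := by rw [← comp_conv, he.e_o, comp_cone]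
  o_e n := by rw [← comp_conv, he.o_e, comp_cone]
  o_e_succ n := by rw [← comp_convCop, he.o_e_succ, comp_cone]
  e_succ_o n := by rw [← comp_convCop, he.e_succ_o, comp_cone]
end

variable (k B)

/-- The free algebra on countably many copies of the vector space `B`. -/
abbrev Free : Type (max u v) := TensorAlgebra k (Bool × ℕ →₀ B)

variable {B}

/-- The generators: `gen k (false, n) x` and `gen k (true, n) x` are the copies of `x` numbered
`2n` and `2n + 1`. -/
noncomputable def gen (p : Bool × ℕ) : B →ₗ[k] Free k B :=
  TensorAlgebra.ι k ∘ₗ Finsupp.lsingle p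

variable (B)

/-- The relations of the Hopf envelope. -/
inductive Rel : Free k B → Free k B → Prop
  | e_one (n) : Rel (gen k (false, n) 1) 1
  | o_one (n) : Rel (gen k (true, n) 1) 1
  | e_mul (n x y) : Rel (gen k (false, n) (x * y)) (gen k (false, n) x * gen k (false, n) y)
  | o_mul (n x y) : Rel (gen k (true, n) (x * y)) (gen k (true, n) y * gen k (true, n) x)
  | e_o (n) (x : B) : Rel (conv (gen k (false, n)) (gen k (true, n)) x)
      (cone k B _ x)
  | o_e (n) (x : B) : Rel (conv (gen k (true, n)) (gen k (false, n)) x)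
      (cone k B _ x)
  | o_e_succ (n) (x : B) : Rel (convCop (gen k (true, n)) (gen k (false, n + 1)) x)
      (cone k B _ x)
  | e_succ_o (n) (x : B) : Rel (convCop (gen k (false, n + 1)) (gen k (true, n)) x)
      (cone k B _ x)

/-- The Hopf envelope of `B`, by generators and relations. -/
def Env : Type (max u v) := RingQuot (Rel k B)

noncomputable instance : Ring (Env k B) := inferInstanceAs (Ring (RingQuot (Rel k B)))
noncomputable instance : Algebra k (Env k B) := inferInstanceAs (Algebra k (RingQuot (Rel k B)))

/-- The quotient map. -/
noncomputable def mk : Free k B →ₐ[k] Env k B := RingQuot.mkAlgHom k (Rel k B)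

variable {k B} in
theorem mk_rel {x y : Free k B} (h : Rel k B x y) : mk k B x = mk k B y :=
  RingQuot.mkAlgHom_rel k h

theorem mk_surjective : Function.Surjective (mk k B) := RingQuot.mkAlgHom_surjective k _

/-- The copy of `B` numbered `2n`. -/
noncomputable def e (n : ℕ) : B →ₗ[k] Env k B := (mk k B).toLinearMap ∘ₗ gen k (false, n)

/-- The copy of `B` numbered `2n + 1`. -/
noncomputable def o (n : ℕ) : B →ₗ[k] Env k B := (mk k B).toLinearMap ∘ₗ gen k (true, n)

theorem isFamily : IsFamily (e k B) (o k B) where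
  e_one n := (mk_rel (.e_one n)).trans (map_one _)
  o_one n := (mk_rel (.o_one n)).trans (map_one _)
  e_mul n x y := (mk_rel (.e_mul n x y)).trans (map_mul _ _ _)
  o_mul n x y := (mk_rel (.o_mul n x y)).trans (map_mul _ _ _)
  e_o n := by
    rw [e, o, ← comp_conv, ← comp_cone (mk k B)]
    exact LinearMap.ext fun x => mk_rel (.e_o n x)
  o_e n := by
    rw [o, e, ← comp_conv, ← comp_cone (mk k B)]
    exact LinearMap.ext fun x => mk_rel (.o_e n x)
  o_e_succ n := by
    rw [o, e, ← comp_convCop, ← comp_cone (mk k B)]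
    exact LinearMap.ext fun x => mk_rel (.o_e_succ n x)
  e_succ_o n := by
    rw [e, o, ← comp_convCop, ← comp_cone (mk k B)]
    exact LinearMap.ext fun x => mk_rel (.e_succ_o n x)

variable {k B}

theorem induction {P : Env k B → Prop} (hr : ∀ r : k, P (algebraMap k _ r))
    (he : ∀ n x, P (e k B n x)) (ho : ∀ n x, P (o k B n x))
    (hm : ∀ a b, P a → P b → P (a * b)) (ha : ∀ a b, P a → P b → P (a + b)) (x : Env k B) : P x := by
  obtain ⟨x, rfl⟩ := mk_surjective k B x
  induction x using TensorAlgebra.induction with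
  | algebraMap r => simpa using hr r
  | ι m =>
    induction m using Finsupp.induction_linear with
    | zero => simpa using hr 0
    | add f g hf hg => simpa using ha _ _ hf hg
    | single p b =>
      obtain ⟨_ | _, n⟩ := p
      · exact he n b
      · exact ho n b
  | mul a b h1 h2 => simpa using hm _ _ h1 h2
  | add a b h1 h2 => simpa using ha _ _ h1 h2

/-- The underlying map on the free algebra of `lift`. -/
noncomputable def liftFree (f g : ℕ → B →ₗ[k] A) : Free k B →ₐ[k] A :=
  TensorAlgebra.lift k (Finsupp.lsum k (fun p : Bool × ℕ => bif p.1 then g p.2 else f p.2))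

@[simp] theorem liftFree_false (f g : ℕ → B →ₗ[k] A) (n : ℕ) (x : B) :
    liftFree f g (gen k (false, n) x) = f n x := by
  simp [liftFree, gen]

@[simp] theorem liftFree_true (f g : ℕ → B →ₗ[k] A) (n : ℕ) (x : B) :
    liftFree f g (gen k (true, n) x) = g n x := by
  simp [liftFree, gen]

theorem liftFree_comp_false (f g : ℕ → B →ₗ[k] A) (n : ℕ) :
    (liftFree f g).toLinearMap ∘ₗ gen k (false, n) = f n := by ext; simp

theorem liftFree_comp_true (f g : ℕ → B →ₗ[k] A) (n : ℕ) :
    (liftFree f g).toLinearMap ∘ₗ gen k (true, n) = g n := by ext; simp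

theorem liftFree_rel {f g : ℕ → B →ₗ[k] A} (h : IsFamily f g) ⦃x y : Free k B⦄ (r : Rel k B x y) :
    liftFree f g x = liftFree f g y := by
  cases r with
  | e_one n => simp [h.e_one]
  | o_one n => simp [h.o_one]
  | e_mul n x y => simp [h.e_mul]
  | o_mul n x y => simp [h.o_mul]
  | e_o n x =>
    have e1 := LinearMap.congr_fun (comp_conv (liftFree f g) (gen k (false, n)) (gen k (true, n))) x
    have e2 := LinearMap.congr_fun (comp_cone (B := B) (liftFree f g)) x
    rw [liftFree_comp_false, liftFree_comp_true, h.e_o, ← e2] at e1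
    exact e1
  | o_e n x =>
    have e1 := LinearMap.congr_fun (comp_conv (liftFree f g) (gen k (true, n)) (gen k (false, n))) x
    have e2 := LinearMap.congr_fun (comp_cone (B := B) (liftFree f g)) x
    rw [liftFree_comp_false, liftFree_comp_true, h.o_e, ← e2] at e1
    exact e1
  | o_e_succ n x =>
    have e1 := LinearMap.congr_fun (comp_convCop (liftFree f g) (gen k (true, n)) (gen k (false, n + 1))) x
    have e2 := LinearMap.congr_fun (comp_cone (B := B) (liftFree f g)) x
    rw [liftFree_comp_false, liftFree_comp_true, h.o_e_succ, ← e2] at e1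
    exact e1
  | e_succ_o n x =>
    have e1 := LinearMap.congr_fun (comp_convCop (liftFree f g) (gen k (false, n + 1)) (gen k (true, n))) x
    have e2 := LinearMap.congr_fun (comp_cone (B := B) (liftFree f g)) x
    rw [liftFree_comp_false, liftFree_comp_true, h.e_succ_o, ← e2] at e1
    exact e1

/-- Algebra maps out of the Hopf envelope. -/
noncomputable def lift {f g : ℕ → B →ₗ[k] A} (h : IsFamily f g) : Env k B →ₐ[k] A :=
  RingQuot.liftAlgHom k ⟨liftFree f g, liftFree_rel h⟩

theorem lift_mk {f g : ℕ → B →ₗ[k] A} (h : IsFamily f g) (x : Free k B) :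
    lift h (mk k B x) = liftFree f g x :=
  RingQuot.liftAlgHom_mkAlgHom_apply k _ _ _

@[simp] theorem lift_e {f g : ℕ → B →ₗ[k] A} (h : IsFamily f g) (n : ℕ) (x : B) :
    lift h (e k B n x) = f n x := (lift_mk h _).trans (liftFree_false f g n x)

@[simp] theorem lift_o {f g : ℕ → B →ₗ[k] A} (h : IsFamily f g) (n : ℕ) (x : B) :
    lift h (o k B n x) = g n x := (lift_mk h _).trans (liftFree_true f g n x)

theorem hom_ext {φ ψ : Env k B →ₐ[k] A} (h : ∀ x, φ (e k B 0 x) = ψ (e k B 0 x)) : φ = ψ := by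
  have H : ∀ n, φ.toLinearMap ∘ₗ e k B n = ψ.toLinearMap ∘ₗ e k B n ∧
      φ.toLinearMap ∘ₗ o k B n = ψ.toLinearMap ∘ₗ o k B n := by
    have key : ∀ n, φ.toLinearMap ∘ₗ e k B n = ψ.toLinearMap ∘ₗ e k B n →
        φ.toLinearMap ∘ₗ o k B n = ψ.toLinearMap ∘ₗ o k B n := by
      intro n hn
      have h1 := ((isFamily k B).comp φ).o_e n
      have h2 := ((isFamily k B).comp ψ).e_o n
      rw [← hn] at h2
      exact conv_unique h1 h2
    intro n
    induction n with
    | zero =>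
      have : φ.toLinearMap ∘ₗ e k B 0 = ψ.toLinearMap ∘ₗ e k B 0 := LinearMap.ext h
      exact ⟨this, key 0 this⟩
    | succ n ih =>
      have : φ.toLinearMap ∘ₗ e k B (n + 1) = ψ.toLinearMap ∘ₗ e k B (n + 1) := by
        have h1 := ((isFamily k B).comp φ).e_succ_o n
        have h2 := ((isFamily k B).comp ψ).o_e_succ n
        rw [← ih.2] at h2
        exact convCop_unique h1 h2
      exact ⟨this, key _ this⟩
  apply AlgHom.ext
  intro x
  induction x using induction with
  | hr r => simp
  | he n x => exact LinearMap.congr_fun (H n).1 x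
  | ho n x => exact LinearMap.congr_fun (H n).2 x
  | hm a b h1 h2 => simp [h1, h2]
  | ha a b h1 h2 => simp [h1, h2]

section Comul

variable {C : Type*} [AddCommGroup C] [Module k C] [Coalgebra k C]

theorem comul_inv {a b : C →ₗ[k] A} (h : toConv a * toConv b = 1) :
    toConv (TensorProduct.map a a ∘ₗ Coalgebra.comul (R := k) (A := C)) *
      toConv (TensorProduct.map b b ∘ₗ (TensorProduct.comm k C C).toLinearMap ∘ₗ
        Coalgebra.comul (R := k) (A := C)) = 1 := by
  let i₁ : A →ₐ[k] A ⊗[k] A := Algebra.TensorProduct.includeLeft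
  let i₂ : A →ₐ[k] A ⊗[k] A := Algebra.TensorProduct.includeRight
  have ha : toConv (TensorProduct.map a a ∘ₗ Coalgebra.comul (R := k) (A := C)) =
      toConv (i₁.toLinearMap ∘ₗ a) * toConv (i₂.toLinearMap ∘ₗ a) := by
    have : TensorProduct.map a a = LinearMap.mul' k (A ⊗[k] A) ∘ₗ
        TensorProduct.map (i₁.toLinearMap ∘ₗ a) (i₂.toLinearMap ∘ₗ a) := by
      ext; simp [i₁, i₂]
    rw [this]; rfl
  have hb : toConv (TensorProduct.map b b ∘ₗ (TensorProduct.comm k C C).toLinearMap ∘ₗ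
        Coalgebra.comul (R := k) (A := C)) =
      toConv (i₂.toLinearMap ∘ₗ b) * toConv (i₁.toLinearMap ∘ₗ b) := by
    have : TensorProduct.map b b ∘ₗ (TensorProduct.comm k C C).toLinearMap =
        LinearMap.mul' k (A ⊗[k] A) ∘ₗ
        TensorProduct.map (i₂.toLinearMap ∘ₗ b) (i₁.toLinearMap ∘ₗ b) := by
      ext; simp [i₁, i₂]
    rw [← LinearMap.comp_assoc, this]; rfl
  have hi : ∀ i : A →ₐ[k] A ⊗[k] A,
      toConv (i.toLinearMap ∘ₗ a) * toConv (i.toLinearMap ∘ₗ b) = 1 := by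
    intro i
    have h1 := LinearMap.algHom_comp_convMul_distrib i (toConv a) (toConv b)
    rw [h] at h1
    apply WithConv.ofConv_injective
    refine h1.symm.trans ?_
    ext; simp
  rw [ha, hb, mul_assoc, ← mul_assoc (toConv (i₂.toLinearMap ∘ₗ a)), hi, one_mul, hi]

theorem comul_inv' {a b : C →ₗ[k] A} (h : toConv b * toConv a = 1) :
      toConv (TensorProduct.map b b ∘ₗ (TensorProduct.comm k C C).toLinearMap ∘ₗ
        Coalgebra.comul (R := k) (A := C)) *
    toConv (TensorProduct.map a a ∘ₗ Coalgebra.comul (R := k) (A := C)) = 1 := by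
  let i₁ : A →ₐ[k] A ⊗[k] A := Algebra.TensorProduct.includeLeft
  let i₂ : A →ₐ[k] A ⊗[k] A := Algebra.TensorProduct.includeRight
  have ha : toConv (TensorProduct.map a a ∘ₗ Coalgebra.comul (R := k) (A := C)) =
      toConv (i₁.toLinearMap ∘ₗ a) * toConv (i₂.toLinearMap ∘ₗ a) := by
    have : TensorProduct.map a a = LinearMap.mul' k (A ⊗[k] A) ∘ₗ
        TensorProduct.map (i₁.toLinearMap ∘ₗ a) (i₂.toLinearMap ∘ₗ a) := by
      ext; simp [i₁, i₂]
    rw [this]; rfl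
  have hb : toConv (TensorProduct.map b b ∘ₗ (TensorProduct.comm k C C).toLinearMap ∘ₗ
        Coalgebra.comul (R := k) (A := C)) =
      toConv (i₂.toLinearMap ∘ₗ b) * toConv (i₁.toLinearMap ∘ₗ b) := by
    have : TensorProduct.map b b ∘ₗ (TensorProduct.comm k C C).toLinearMap =
        LinearMap.mul' k (A ⊗[k] A) ∘ₗ
        TensorProduct.map (i₂.toLinearMap ∘ₗ b) (i₁.toLinearMap ∘ₗ b) := by
      ext; simp [i₁, i₂]
    rw [← LinearMap.comp_assoc, this]; rfl
  have hi : ∀ i : A →ₐ[k] A ⊗[k] A,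
      toConv (i.toLinearMap ∘ₗ b) * toConv (i.toLinearMap ∘ₗ a) = 1 := by
    intro i
    have h1 := LinearMap.algHom_comp_convMul_distrib i (toConv b) (toConv a)
    rw [h] at h1
    apply WithConv.ofConv_injective
    refine h1.symm.trans ?_
    ext; simp
  rw [ha, hb, mul_assoc, ← mul_assoc (toConv (i₁.toLinearMap ∘ₗ b)), hi, one_mul, hi]

end Comul

theorem map_mul_tensor {f : B →ₗ[k] A} (hf : ∀ x y, f (x * y) = f x * f y) (s t : B ⊗[k] B) :
    TensorProduct.map f f (s * t) = TensorProduct.map f f s * TensorProduct.map f f t := by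
  induction s using TensorProduct.induction_on with
  | zero => simp
  | add s s' h h' => simp [add_mul, h, h']
  | tmul a b =>
    induction t using TensorProduct.induction_on with
    | zero => simp
    | add t t' h h' => simp [mul_add, h, h']
    | tmul c d => simp [hf]

theorem map_mul_tensor' {f : B →ₗ[k] A} (hf : ∀ x y, f (x * y) = f y * f x) (s t : B ⊗[k] B) :
    TensorProduct.map f f (s * t) = TensorProduct.map f f t * TensorProduct.map f f s := by
  induction s using TensorProduct.induction_on with
  | zero => simp
  | add s s' h h' => simp [add_mul, mul_add, h, h']
  | tmul a b =>
    induction t using TensorProduct.induction_on with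
    | zero => simp
    | add t t' h h' => simp [add_mul, mul_add, h, h']
    | tmul c d => simp [hf]

theorem comulCop_mul (x y : B) : comulCop k B (x * y) = comulCop k B x * comulCop k B y := by
  simp only [comulCop, LinearMap.comp_apply, Bialgebra.comul_mul]
  exact map_mul (Algebra.TensorProduct.comm k B B) _ _

theorem comulCop_one : comulCop k B 1 = 1 := by
  simp [comulCop, Algebra.TensorProduct.one_def]

theorem comm_comulCop : (TensorProduct.comm k B B).toLinearMap ∘ₗ comulCop k B =
    Coalgebra.comul := by
  ext x; simp [comulCop]

theorem conv_comul {a b : B →ₗ[k] A} (h : conv a b = cone k B A) :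
    conv (TensorProduct.map a a ∘ₗ Coalgebra.comul) (TensorProduct.map b b ∘ₗ comulCop k B) =
      cone k B (A ⊗[k] A) :=
  congrArg ofConv (comul_inv (C := B) (a := a) (b := b) (congrArg toConv h))

theorem conv_comul' {a b : B →ₗ[k] A} (h : conv b a = cone k B A) :
    conv (TensorProduct.map b b ∘ₗ comulCop k B) (TensorProduct.map a a ∘ₗ Coalgebra.comul) =
      cone k B (A ⊗[k] A) :=
  congrArg ofConv (comul_inv' (C := B) (a := a) (b := b) (congrArg toConv h))

theorem convCop_comul {a b : B →ₗ[k] A} (h : convCop a b = cone k B A) :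
    convCop (TensorProduct.map a a ∘ₗ comulCop k B) (TensorProduct.map b b ∘ₗ Coalgebra.comul) =
      cone k B (A ⊗[k] A) := by
  let a' : Cop B →ₗ[k] A := a
  let b' : Cop B →ₗ[k] A := b
  have h' : toConv a' * toConv b' = 1 := congrArg toConv h
  have := congrArg ofConv (comul_inv h')
  rw [← comm_comulCop]
  exact this

theorem convCop_comul' {a b : B →ₗ[k] A} (h : convCop b a = cone k B A) :
    convCop (TensorProduct.map b b ∘ₗ Coalgebra.comul) (TensorProduct.map a a ∘ₗ comulCop k B) =
      cone k B (A ⊗[k] A) := by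
  let a' : Cop B →ₗ[k] A := a
  let b' : Cop B →ₗ[k] A := b
  have h' : toConv b' * toConv a' = 1 := congrArg toConv h
  have := congrArg ofConv (comul_inv' h')
  rw [← comm_comulCop]
  exact this

variable (k B)

theorem isFamily_comul : IsFamily
    (fun n => TensorProduct.map (e k B n) (e k B n) ∘ₗ Coalgebra.comul)
    (fun n => TensorProduct.map (o k B n) (o k B n) ∘ₗ comulCop k B) where
  e_one n := by simp [Algebra.TensorProduct.one_def, (isFamily k B).e_one]
  o_one n := by simp [comulCop_one, Algebra.TensorProduct.one_def, (isFamily k B).o_one]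
  e_mul n x y := by simp [map_mul_tensor ((isFamily k B).e_mul n)]
  o_mul n x y := by simp [comulCop_mul, map_mul_tensor' ((isFamily k B).o_mul n)]
  e_o n := conv_comul ((isFamily k B).e_o n)
  o_e n := conv_comul' ((isFamily k B).o_e n)
  o_e_succ n := convCop_comul ((isFamily k B).o_e_succ n)
  e_succ_o n := convCop_comul' ((isFamily k B).e_succ_o n)

theorem isFamily_counit : IsFamily (A := k) (fun _ : ℕ => Coalgebra.counit (R := k) (A := B))
    (fun _ => Coalgebra.counit) := by
  have h1 : conv (Coalgebra.counit (R := k) (A := B)) Coalgebra.counit = cone k B k :=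
    congrArg ofConv (one_mul (1 : WithConv (B →ₗ[k] k)))
  have h2 : convCop (Coalgebra.counit (R := k) (A := B)) Coalgebra.counit = cone k B k :=
    congrArg ofConv (one_mul (1 : WithConv (Cop B →ₗ[k] k)))
  exact ⟨by simp, by simp, by simp, by simp [mul_comm], fun _ => h1, fun _ => h1, fun _ => h2,
    fun _ => h2⟩

noncomputable def comulHom : Env k B →ₐ[k] Env k B ⊗[k] Env k B := lift (isFamily_comul k B)
noncomputable def counitHom : Env k B →ₐ[k] k := lift (isFamily_counit k B)

theorem comulHom_e (n : ℕ) (x : B) : comulHom k B (e k B n x) =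
    TensorProduct.map (e k B n) (e k B n) (Coalgebra.comul x) := lift_e _ _ _

theorem comulHom_o (n : ℕ) (x : B) : comulHom k B (o k B n x) =
    TensorProduct.map (o k B n) (o k B n) (comulCop k B x) := lift_o _ _ _

theorem counitHom_e (n : ℕ) (x : B) : counitHom k B (e k B n x) =
    Coalgebra.counit (R := k) x := lift_e _ _ _

theorem counitHom_o (n : ℕ) (x : B) : counitHom k B (o k B n x) =
    Coalgebra.counit (R := k) x := lift_o _ _ _

noncomputable instance : Bialgebra k (Env k B) :=
  Bialgebra.ofAlgHom (comulHom k B) (counitHom k B)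
    (hom_ext fun x => by
      have h1 : (Algebra.TensorProduct.assoc k k k (Env k B) (Env k B) (Env k B)).toLinearMap ∘ₗ
          (Algebra.TensorProduct.map (comulHom k B) (.id k (Env k B))).toLinearMap ∘ₗ
          TensorProduct.map (e k B 0) (e k B 0) =
          TensorProduct.map (e k B 0) (TensorProduct.map (e k B 0) (e k B 0)) ∘ₗ
            (TensorProduct.assoc k B B B).toLinearMap ∘ₗ
            (Coalgebra.comul (R := k) (A := B)).rTensor B := by
        ext a b
        simp only [TensorProduct.AlgebraTensorModule.curry_apply,
          LinearMap.restrictScalars_self, TensorProduct.curry_apply, LinearMap.comp_apply,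
          TensorProduct.map_tmul, LinearMap.rTensor_tmul, AlgHom.toLinearMap_apply,
          Algebra.TensorProduct.map_tmul, comulHom_e]
        induction Coalgebra.comul (R := k) a using TensorProduct.induction_on with
        | zero => simp
        | tmul x y => simp
        | add x y hx hy => simp only [map_add, TensorProduct.add_tmul, hx, hy]
      have h2 : (Algebra.TensorProduct.map (.id k (Env k B)) (comulHom k B)).toLinearMap ∘ₗ
          TensorProduct.map (e k B 0) (e k B 0) =
          TensorProduct.map (e k B 0) (TensorProduct.map (e k B 0) (e k B 0)) ∘ₗ
            (Coalgebra.comul (R := k) (A := B)).lTensor B := by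
        ext a b
        simp [comulHom_e]
      have e1 := LinearMap.congr_fun h1 (Coalgebra.comul x)
      have e2 := LinearMap.congr_fun h2 (Coalgebra.comul x)
      simp only [AlgHom.comp_apply, comulHom_e]
      refine e1.trans (Eq.trans ?_ e2.symm)
      exact congrArg (TensorProduct.map (e k B 0) (TensorProduct.map (e k B 0) (e k B 0)))
        (Coalgebra.coassoc_apply x))
    (hom_ext fun x => by
      have h1 : (Algebra.TensorProduct.map (counitHom k B) (.id k (Env k B))).toLinearMap ∘ₗ
          TensorProduct.map (e k B 0) (e k B 0) =
          (e k B 0).lTensor k ∘ₗ (Coalgebra.counit (R := k) (A := B)).rTensor B := by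
        ext a b
        simp [counitHom_e]
      simp only [AlgHom.comp_apply, comulHom_e]
      refine (LinearMap.congr_fun h1 (Coalgebra.comul x)).trans ?_
      rw [LinearMap.comp_apply, Coalgebra.rTensor_counit_comul]
      simp)
    (hom_ext fun x => by
      have h1 : (Algebra.TensorProduct.map (.id k (Env k B)) (counitHom k B)).toLinearMap ∘ₗ
          TensorProduct.map (e k B 0) (e k B 0) =
          (e k B 0).rTensor k ∘ₗ (Coalgebra.counit (R := k) (A := B)).lTensor B := by
        ext a b
        simp [counitHom_e]
      simp only [AlgHom.comp_apply, comulHom_e]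
      refine (LinearMap.congr_fun h1 (Coalgebra.comul x)).trans ?_
      rw [LinearMap.comp_apply, Coalgebra.lTensor_counit_comul]
      simp)

variable {k B}

/-- The canonical linear map from an algebra to its opposite. -/
def opL : A →ₗ[k] Aᵐᵒᵖ := (MulOpposite.opLinearEquiv k).toLinearMap

theorem mul'_opL (f g : B →ₗ[k] A) :
    LinearMap.mul' k Aᵐᵒᵖ ∘ₗ TensorProduct.map (opL ∘ₗ f) (opL ∘ₗ g) =
      opL ∘ₗ LinearMap.mul' k A ∘ₗ TensorProduct.map g f ∘ₗ
        (TensorProduct.comm k B B).toLinearMap := by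
  ext; simp [opL]

theorem conv_opL (f g : B →ₗ[k] A) : conv (opL ∘ₗ f) (opL ∘ₗ g) = opL ∘ₗ convCop g f :=
  congrArg (fun F => F ∘ₗ Coalgebra.comul) (mul'_opL f g)

theorem convCop_opL (f g : B →ₗ[k] A) : convCop (opL ∘ₗ f) (opL ∘ₗ g) = opL ∘ₗ conv g f := by
  have := congrArg (fun F => F ∘ₗ comulCop k B) (mul'_opL f g)
  refine this.trans ?_
  simp only [LinearMap.comp_assoc, comm_comulCop]
  rfl

theorem cone_opL : opL ∘ₗ cone k B A = cone k B Aᵐᵒᵖ := rfl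

variable (k B)

theorem isFamily_antipode : IsFamily (fun n => opL ∘ₗ o k B n) (fun n => opL ∘ₗ e k B (n + 1)) where
  e_one n := by simp [opL, (isFamily k B).o_one]
  o_one n := by simp [opL, (isFamily k B).e_one]
  e_mul n x y := by simp [opL, (isFamily k B).o_mul]
  o_mul n x y := by simp [opL, (isFamily k B).e_mul]
  e_o n := by rw [conv_opL, (isFamily k B).e_succ_o, cone_opL]
  o_e n := by rw [conv_opL, (isFamily k B).o_e_succ, cone_opL]
  o_e_succ n := by rw [convCop_opL, (isFamily k B).o_e, cone_opL]
  e_succ_o n := by rw [convCop_opL, (isFamily k B).e_o, cone_opL]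

/-- The antipode of the Hopf envelope. -/
noncomputable def anti : Env k B →ₗ[k] Env k B :=
  (MulOpposite.opLinearEquiv k).symm.toLinearMap ∘ₗ (lift (isFamily_antipode k B)).toLinearMap

theorem anti_e (n : ℕ) (x : B) : anti k B (e k B n x) = o k B n x :=
  congrArg MulOpposite.unop (lift_e (isFamily_antipode k B) n x)

theorem anti_o (n : ℕ) (x : B) : anti k B (o k B n x) = e k B (n + 1) x :=
  congrArg MulOpposite.unop (lift_o (isFamily_antipode k B) n x)

theorem anti_one : anti k B 1 = 1 :=
  congrArg MulOpposite.unop (map_one (lift (isFamily_antipode k B)))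

theorem anti_mul (x y : Env k B) : anti k B (x * y) = anti k B y * anti k B x :=
  congrArg MulOpposite.unop (map_mul (lift (isFamily_antipode k B)) x y)

variable {k} in
theorem left_mul {S : A →ₗ[k] A} (hS : ∀ x y, S (x * y) = S y * S x) (t s : A ⊗[k] A) (c : k)
    (ht : LinearMap.mul' k A (TensorProduct.map S LinearMap.id t) = algebraMap k A c) :
    LinearMap.mul' k A (TensorProduct.map S LinearMap.id (t * s)) =
      c • LinearMap.mul' k A (TensorProduct.map S LinearMap.id s) := by
  induction s using TensorProduct.induction_on with
  | zero => simp
  | add s s' h h' => simp [mul_add, h, h']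
  | tmul a b =>
    have : LinearMap.mul' k A (TensorProduct.map S LinearMap.id (t * a ⊗ₜ b)) =
        S a * LinearMap.mul' k A (TensorProduct.map S LinearMap.id t) * b := by
      clear ht
      induction t using TensorProduct.induction_on with
      | zero => simp
      | add s s' h h' => simp [add_mul, mul_add, h, h']
      | tmul c d => simp [hS, mul_assoc]
    rw [this, ht, ← Algebra.commutes, mul_assoc, ← Algebra.smul_def]
    simp

variable {k} in
theorem right_mul {S : A →ₗ[k] A} (hS : ∀ x y, S (x * y) = S y * S x) (t s : A ⊗[k] A) (c : k)
    (hs : LinearMap.mul' k A (TensorProduct.map LinearMap.id S s) = algebraMap k A c) :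
    LinearMap.mul' k A (TensorProduct.map LinearMap.id S (t * s)) =
      c • LinearMap.mul' k A (TensorProduct.map LinearMap.id S t) := by
  induction t using TensorProduct.induction_on with
  | zero => simp
  | add s s' h h' => simp [add_mul, h, h']
  | tmul a b =>
    have : LinearMap.mul' k A (TensorProduct.map LinearMap.id S (a ⊗ₜ b * s)) =
        a * LinearMap.mul' k A (TensorProduct.map LinearMap.id S s) * S b := by
      clear hs
      induction s using TensorProduct.induction_on with
      | zero => simp
      | add s s' h h' => simp [add_mul, mul_add, h, h']
      | tmul c d => simp [hS, mul_assoc]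
    rw [this, hs, ← Algebra.commutes, mul_assoc, ← Algebra.smul_def]
    simp

theorem comul_e (n : ℕ) (x : B) : Coalgebra.comul (R := k) (e k B n x) =
    TensorProduct.map (e k B n) (e k B n) (Coalgebra.comul x) := comulHom_e k B n x

theorem comul_o (n : ℕ) (x : B) : Coalgebra.comul (R := k) (o k B n x) =
    TensorProduct.map (o k B n) (o k B n) (comulCop k B x) := comulHom_o k B n x

theorem counit_e (n : ℕ) (x : B) : Coalgebra.counit (R := k) (e k B n x) =
    Coalgebra.counit (R := k) x := counitHom_e k B n x

theorem counit_o (n : ℕ) (x : B) : Coalgebra.counit (R := k) (o k B n x) =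
    Coalgebra.counit (R := k) x := counitHom_o k B n x

theorem anti_comp_e (n : ℕ) : anti k B ∘ₗ e k B n = o k B n := LinearMap.ext (anti_e k B n)

theorem anti_comp_o (n : ℕ) : anti k B ∘ₗ o k B n = e k B (n + 1) := LinearMap.ext (anti_o k B n)

theorem anti_left (x : Env k B) :
    LinearMap.mul' k _ (TensorProduct.map (anti k B) LinearMap.id (Coalgebra.comul x)) =
      algebraMap k _ (Coalgebra.counit (R := k) x) := by
  induction x using induction with
  | hr r => simp [Algebra.TensorProduct.one_def, Algebra.algebraMap_eq_smul_one, anti_one]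
  | he n x =>
    rw [comul_e, counit_e, TensorProduct.map_map, anti_comp_e, LinearMap.id_comp]
    exact LinearMap.congr_fun ((isFamily k B).o_e n) x
  | ho n x =>
    rw [comul_o, counit_o, TensorProduct.map_map, anti_comp_o, LinearMap.id_comp]
    exact LinearMap.congr_fun ((isFamily k B).e_succ_o n) x
  | hm a b h1 h2 =>
    rw [Bialgebra.comul_mul, left_mul (anti_mul k B) _ _ _ h1, h2, Bialgebra.counit_mul, map_mul,
      Algebra.smul_def]
  | ha a b h1 h2 => simp only [map_add, h1, h2]

theorem anti_right (x : Env k B) :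
    LinearMap.mul' k _ (TensorProduct.map LinearMap.id (anti k B) (Coalgebra.comul x)) =
      algebraMap k _ (Coalgebra.counit (R := k) x) := by
  induction x using induction with
  | hr r => simp [Algebra.TensorProduct.one_def, Algebra.algebraMap_eq_smul_one, anti_one]
  | he n x =>
    rw [comul_e, counit_e, TensorProduct.map_map, anti_comp_e, LinearMap.id_comp]
    exact LinearMap.congr_fun ((isFamily k B).e_o n) x
  | ho n x =>
    rw [comul_o, counit_o, TensorProduct.map_map, anti_comp_o, LinearMap.id_comp]
    exact LinearMap.congr_fun ((isFamily k B).o_e_succ n) x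
  | hm a b h1 h2 =>
    rw [Bialgebra.comul_mul, right_mul (anti_mul k B) _ _ _ h2, h1, Bialgebra.counit_mul, mul_comm,
      map_mul, Algebra.smul_def]
  | ha a b h1 h2 => simp only [map_add, h1, h2]

noncomputable instance : HopfAlgebra k (Env k B) where
  antipode := anti k B
  mul_antipode_rTensor_comul := LinearMap.ext (anti_left k B)
  mul_antipode_lTensor_comul := LinearMap.ext (anti_right k B)

/-- The canonical bialgebra map from `B` to its Hopf envelope. -/
noncomputable def of : B →ₐc[k] Env k B :=
  BialgHom.ofAlgHom
    (AlgHom.ofLinearMap (e k B 0) ((isFamily k B).e_one 0) ((isFamily k B).e_mul 0))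
    (AlgHom.ext fun x => counit_e k B 0 x)
    (AlgHom.ext fun x => (comul_e k B 0 x).symm)

theorem of_apply (x : B) : of k B x = e k B 0 x := rfl

section universal

variable {k B} {L : Type w} [Ring L] [HopfAlgebra k L]

theorem antipode_conv (f g : B →ₗ[k] L) : HopfAlgebra.antipode k ∘ₗ conv f g =
    convCop (HopfAlgebra.antipode k ∘ₗ g) (HopfAlgebra.antipode k ∘ₗ f) := by
  have : HopfAlgebra.antipode k ∘ₗ LinearMap.mul' k L ∘ₗ TensorProduct.map f g =
      LinearMap.mul' k L ∘ₗ TensorProduct.map (HopfAlgebra.antipode k ∘ₗ g)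
        (HopfAlgebra.antipode k ∘ₗ f) ∘ₗ (TensorProduct.comm k B B).toLinearMap := by
    ext; simp [HopfAlgebra.antipode_mul_antidistrib]
  exact congrArg (fun F => F ∘ₗ Coalgebra.comul) this

theorem antipode_convCop (f g : B →ₗ[k] L) : HopfAlgebra.antipode k ∘ₗ convCop f g =
    conv (HopfAlgebra.antipode k ∘ₗ g) (HopfAlgebra.antipode k ∘ₗ f) := by
  have : HopfAlgebra.antipode k ∘ₗ LinearMap.mul' k L ∘ₗ TensorProduct.map f g =
      LinearMap.mul' k L ∘ₗ TensorProduct.map (HopfAlgebra.antipode k ∘ₗ g)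
        (HopfAlgebra.antipode k ∘ₗ f) ∘ₗ (TensorProduct.comm k B B).toLinearMap := by
    ext; simp [HopfAlgebra.antipode_mul_antidistrib]
  refine (congrArg (fun F => F ∘ₗ comulCop k B) this).trans ?_
  simp only [LinearMap.comp_assoc, comm_comulCop]
  rfl

theorem antipode_cone : HopfAlgebra.antipode k ∘ₗ cone k B L = cone k B L := by
  ext; simp [cone, Algebra.algebraMap_eq_smul_one]

/-- The maps `S^m ∘ g`. -/
noncomputable def iter (g : B →ₗ[k] L) : ℕ → B →ₗ[k] L
  | 0 => g
  | m + 1 => HopfAlgebra.antipode k ∘ₗ iter g m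

theorem iter_spec (g : B →ₐc[k] L) (n : ℕ) :
    let p := iter (g : B →ₐ[k] L).toLinearMap
    p (2 * n) 1 = 1 ∧ (∀ x y, p (2 * n) (x * y) = p (2 * n) x * p (2 * n) y) ∧
      conv (p (2 * n)) (p (2 * n + 1)) = cone k B L ∧
      conv (p (2 * n + 1)) (p (2 * n)) = cone k B L := by
  intro p
  have hp : ∀ m, p (m + 1) = HopfAlgebra.antipode k ∘ₗ p m := fun _ => rfl
  induction n with
  | zero =>
    have hg : TensorProduct.map (p 0) (p 0) ∘ₗ Coalgebra.comul = Coalgebra.comul ∘ₗ p 0 :=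
      LinearMap.ext fun x => CoalgHomClass.map_comp_comul_apply g x
    have hc : Coalgebra.counit ∘ₗ p 0 = Coalgebra.counit (R := k) (A := B) :=
      LinearMap.ext fun x => CoalgHomClass.counit_comp_apply g x
    have h1 : TensorProduct.map (p 0) (HopfAlgebra.antipode k ∘ₗ p 0) =
        (HopfAlgebra.antipode k).lTensor L ∘ₗ TensorProduct.map (p 0) (p 0) := by
      rw [LinearMap.lTensor_comp_map]
    have h2 : TensorProduct.map (HopfAlgebra.antipode k ∘ₗ p 0) (p 0) =
        (HopfAlgebra.antipode k).rTensor L ∘ₗ TensorProduct.map (p 0) (p 0) := by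
      rw [LinearMap.rTensor_comp_map]
    refine ⟨map_one g, map_mul g, ?_, ?_⟩
    · simp only [mul_zero, hp, conv, cone]
      rw [h1, LinearMap.comp_assoc, hg, ← hc]
      exact congrArg (fun F => F ∘ₗ p 0) HopfAlgebra.mul_antipode_lTensor_comul
    · simp only [mul_zero, hp, conv, cone]
      rw [h2, LinearMap.comp_assoc, hg, ← hc]
      exact congrArg (fun F => F ∘ₗ p 0) HopfAlgebra.mul_antipode_rTensor_comul
  | succ n ih =>
    obtain ⟨i1, i2, i3, i4⟩ := ih
    have e1 : p (2 * (n + 1)) = HopfAlgebra.antipode k ∘ₗ HopfAlgebra.antipode k ∘ₗ p (2 * n) := rfl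
    refine ⟨by simp [e1, i1], by simp [e1, i2, HopfAlgebra.antipode_mul_antidistrib], ?_, ?_⟩
    · have := congrArg (fun F => HopfAlgebra.antipode k ∘ₗ HopfAlgebra.antipode k ∘ₗ F) i3
      simp only [antipode_conv, antipode_convCop, antipode_cone] at this
      exact this
    · have := congrArg (fun F => HopfAlgebra.antipode k ∘ₗ HopfAlgebra.antipode k ∘ₗ F) i4
      simp only [antipode_conv, antipode_convCop, antipode_cone] at this
      exact this

theorem isFamily_iter (g : B →ₐc[k] L) :
    IsFamily (fun n => iter (g : B →ₐ[k] L).toLinearMap (2 * n))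
      (fun n => iter (g : B →ₐ[k] L).toLinearMap (2 * n + 1)) where
  e_one n := (iter_spec g n).1
  o_one n := by simp [iter, (iter_spec g n).1]
  e_mul n := (iter_spec g n).2.1
  o_mul n x y := by simp [iter, (iter_spec g n).2.1, HopfAlgebra.antipode_mul_antidistrib]
  e_o n := (iter_spec g n).2.2.1
  o_e n := (iter_spec g n).2.2.2
  o_e_succ n := by
    have := congrArg (fun F => HopfAlgebra.antipode k ∘ₗ F) (iter_spec g n).2.2.2
    simp only [antipode_conv, antipode_cone] at this
    exact this
  e_succ_o n := by
    have := congrArg (fun F => HopfAlgebra.antipode k ∘ₗ F) (iter_spec g n).2.2.1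
    simp only [antipode_conv, antipode_cone] at this
    exact this

theorem existsUnique_lift (g : B →ₐc[k] L) : ∃! f : Env k B →ₐc[k] L, f.comp (of k B) = g := by
  let F : Env k B →ₐ[k] L := lift (isFamily_iter g)
  have hF : ∀ x, F (e k B 0 x) = g x := fun x => lift_e (isFamily_iter g) 0 x
  have h1 : (Bialgebra.counitAlgHom k L).comp F = Bialgebra.counitAlgHom k (Env k B) :=
    hom_ext fun x => by simp [hF, counit_e]
  have h2 : (Algebra.TensorProduct.map F F).comp (Bialgebra.comulAlgHom k (Env k B)) =
      (Bialgebra.comulAlgHom k L).comp F :=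
    hom_ext fun x => by
      have h : (Algebra.TensorProduct.map F F).toLinearMap ∘ₗ
          TensorProduct.map (e k B 0) (e k B 0) =
          TensorProduct.map (g : B →ₐ[k] L).toLinearMap (g : B →ₐ[k] L).toLinearMap := by
        ext; simp [hF]
      simp only [AlgHom.comp_apply, Bialgebra.comulAlgHom_apply, comul_e, hF]
      exact (LinearMap.congr_fun h (Coalgebra.comul x)).trans
        (CoalgHomClass.map_comp_comul_apply g x)
  refine ⟨BialgHom.ofAlgHom F h1 h2, BialgHom.ext hF, fun f hf => ?_⟩
  have : (f : Env k B →ₐ[k] L) = F := hom_ext fun x => by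
    rw [hF, ← hf]; rfl
  exact BialgHom.ext fun x => AlgHom.congr_fun this x

end universal

end

theorem isHopfEnvelope (k B : Type u) [Field k] [Ring B] [Bialgebra k B] :
    IsHopfEnvelope (of k B) := fun _ _ _ g => existsUnique_lift g

end HopfEnvelope

/-- The product `r * s = r φ^{|r|}(s)` (`r` homogeneous) of the right Zhang twist `A^φ` of an
algebra `A` with a `ℤ`-grading `𝓐`; for general `r` it is extended linearly along the
decomposition of `r` into homogeneous components. -/
noncomputable def zhangTwistMul {k A : Type*} [Field k] [Ring A] [Algebra k A]
    (𝓐 : ℤ → Submodule k A) (h𝓐 : DirectSum.IsInternal 𝓐) (φ : A ≃ₐ[k] A) : A ⊗[k] A →ₗ[k] A :=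
  letI := h𝓐.chooseDecomposition
  TensorProduct.lift
    (DirectSum.toModule k ℤ (A →ₗ[k] A)
        (fun n => ((LinearMap.mul k A).compl₂ (φ ^ n).toLinearMap) ∘ₗ (𝓐 n).subtype) ∘ₗ
      (DirectSum.decomposeLinearEquiv 𝓐).toLinearMap)

/-- The value of the Zhang twist product on homogeneous elements. -/
theorem zhangTwistMul_apply {k A : Type*} [Field k] [Ring A] [Algebra k A]
    (𝓐 : ℤ → Submodule k A) (h𝓐 : DirectSum.IsInternal 𝓐) (φ : A ≃ₐ[k] A)
    (n : ℤ) (r s : A) (hr : r ∈ 𝓐 n) :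
    zhangTwistMul 𝓐 h𝓐 φ (r ⊗ₜ s) = r * (φ ^ n) s := by
  let := h𝓐.chooseDecomposition
  have h : DirectSum.decompose 𝓐 r = DirectSum.lof k ℤ (fun n => 𝓐 n) n ⟨r, hr⟩ :=
    DirectSum.decompose_of_mem 𝓐 hr
  simp only [zhangTwistMul, TensorProduct.lift.tmul, LinearMap.comp_apply, LinearEquiv.coe_coe,
    DirectSum.decomposeLinearEquiv_apply]
  erw [h, DirectSum.toModule_lof]
  rfl

/-- A convolution-invertible `σ : H ⊗ H → k` is a 2-cocycle if
`∑ σ(x₁, y₁) σ(x₂ y₂, z) = ∑ σ(y₁, z₁) σ(x, y₂ z₂)` and `σ(x, 1) = σ(1, x) = ε(x)`. Here the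
product of `WithConv` is convolution of linear maps on the coalgebra `H ⊗ H`. -/
structure IsTwoCocycle {k H : Type*} [Field k] [Ring H] [HopfAlgebra k H]
    (σ : (WithConv (H ⊗[k] H →ₗ[k] k))ˣ) : Prop where
  cocycle : ∀ x y z : H,
    (σ.val * WithConv.toConv
        (σ.val.ofConv ∘ₗ (TensorProduct.mk k H H).flip z ∘ₗ LinearMap.mul' k H)) (x ⊗ₜ y) =
    (σ.val * WithConv.toConv
        (σ.val.ofConv ∘ₗ TensorProduct.mk k H H x ∘ₗ LinearMap.mul' k H)) (y ⊗ₜ z)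
  apply_one : ∀ x : H, σ.val (x ⊗ₜ 1) = Coalgebra.counit x
  one_apply : ∀ x : H, σ.val (1 ⊗ₜ x) = Coalgebra.counit x

/-- The product `x * y = ∑ σ(x₁, y₁) x₂ y₂ σ⁻¹(x₃, y₃)` of the 2-cocycle twist `H^σ`, written as
a threefold convolution product in `Hom(H ⊗ H, H)`. -/
noncomputable def cocycleTwistMul {k H : Type*} [Field k] [Ring H] [HopfAlgebra k H]
    (σ : (WithConv (H ⊗[k] H →ₗ[k] k))ˣ) : H ⊗[k] H →ₗ[k] H :=
  (WithConv.toConv (Algebra.linearMap k H ∘ₗ σ.val.ofConv) *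
    WithConv.toConv (LinearMap.mul' k H) *
    WithConv.toConv (Algebra.linearMap k H ∘ₗ σ.inv.ofConv)).ofConv

/-- The product `μ`, together with the coalgebra structure and the unit of `H`, makes the vector
space `H` a Hopf algebra. -/
structure IsHopfProduct {k H : Type*} [Field k] [Ring H] [HopfAlgebra k H]
    (μ : H ⊗[k] H →ₗ[k] H) : Prop where
  assoc : ∀ x y z : H, μ (μ (x ⊗ₜ y) ⊗ₜ z) = μ (x ⊗ₜ μ (y ⊗ₜ z))
  one_mul : ∀ x : H, μ (1 ⊗ₜ x) = x
  mul_one : ∀ x : H, μ (x ⊗ₜ 1) = x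
  comul_comp : Coalgebra.comul ∘ₗ μ = TensorProduct.map μ μ ∘ₗ Coalgebra.comul
  counit_comp : Coalgebra.counit ∘ₗ μ = Coalgebra.counit
  exists_antipode : ∃ S : H →ₗ[k] H,
    μ ∘ₗ TensorProduct.map S LinearMap.id ∘ₗ Coalgebra.comul =
      Algebra.linearMap k H ∘ₗ Coalgebra.counit ∧
    μ ∘ₗ TensorProduct.map LinearMap.id S ∘ₗ Coalgebra.comul =
      Algebra.linearMap k H ∘ₗ Coalgebra.counit

/-! A twisting pair is the same thing as a convolution invertible character. Applying `ε` to one leg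
of the two comultiplication conditions gives `φ₁(x) = ∑ x₁ α(x₂)` and `φ₂(x) = ∑ β(x₁) x₂` with `α =
ε ∘ φ₁` and `β = ε ∘ φ₂`, and `ε ∘ φ₁ ∘ φ₂ = ε` makes `α` and `β` convolution inverse. Hence `φ₁`
and `φ₂` commute, `φ₁ ∘ φ₂` is a bialgebra map, and `n ↦ ε ∘ φ₂ⁿ` turns addition of exponents into
convolution.

The Hopf envelope enters through two facts. Algebra maps out of `H` are determined on `i(B)`
(`IsHopfEnvelope.algHom_ext`), because `H` is a retract of the presented envelope, where uniqueness
of convolution inverses fixes all further generators. And an invertible character of `B` extends to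
`H` (`IsHopfEnvelope.exists_character`). Translating by the extended characters gives the twisting
pair of `H`; its axioms are equalities of algebra maps, so they are checked on `i(B)`.

An algebra grading is likewise a coaction `x ↦ x T^|x|` of the group algebra of `ℤ`, and (T2) makes
the map `b ↦ i(b) T^|b|` a bialgebra map from `B` to the Hopf algebra `H[T, T⁻¹]`. The universal
property extends it to `H` (`exists_coaction`). Its homogeneous components form the grading, and
that it is a coalgebra map gives (T2) again.

For the cocycle, `Δ` preserves degrees, so on `H_n ⊗ H_m` the form `σ` is the pure tensor `ε ⊗ (ε ∘
Φ₂ⁿ)` and convolution splits over the two factors (`convMul_tmul`). The cocycle identity becomes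
additivity of exponents, and the twisted product is `x (ε∘Φ₂ⁿ * id * ε∘Φ₂⁻ⁿ)(y) = x (Φ₁Φ₂)ⁿ(y)`, the
Zhang product. Since `Φ₁Φ₂` is a graded bialgebra automorphism, the Zhang twist is a Hopf algebra.
-/

section

open WithConv

/-! ### Twisting pairs as translations by convolution inverse characters. -/

section TwistingPair

variable {k B A : Type*} [Field k] [Ring B] [Bialgebra k B] [Ring A] [Algebra k A]

/-- The scalar functional `f`, viewed as a map to the algebra `A`. -/
noncomputable def scalarConv (A : Type*) [Ring A] [Algebra k A] (f : B →ₗ[k] k) :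
    WithConv (B →ₗ[k] A) :=
  toConv (Algebra.linearMap k A ∘ₗ f)

theorem scalarConv_counit : scalarConv A (Coalgebra.counit (R := k) (A := B)) = 1 := rfl

theorem scalarConv_commute (f : B →ₗ[k] k) (g : WithConv (B →ₗ[k] A)) (x y : B) :
    Commute (g.ofConv x) ((scalarConv A f).ofConv y) :=
  (Algebra.commutes _ _).symm

/-- If `Δθ = (θ ⊗ id)Δ`, then `f ∘ θ = (ε ∘ θ) * f`. -/
theorem scalarConv_mul {θ : B →ₗ[k] B}
    (h : Coalgebra.comul ∘ₗ θ = TensorProduct.map θ LinearMap.id ∘ₗ Coalgebra.comul (R := k))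
    (f : B →ₗ[k] A) : scalarConv A (Coalgebra.counit ∘ₗ θ) * toConv f = toConv (f ∘ₗ θ) := by
  have h1 : LinearMap.mul' k A ∘ₗ
      TensorProduct.map (Algebra.linearMap k A ∘ₗ Coalgebra.counit ∘ₗ θ) f =
      f ∘ₗ (TensorProduct.lid k B).toLinearMap ∘ₗ Coalgebra.counit.rTensor B ∘ₗ
        TensorProduct.map θ LinearMap.id := by
    ext; simp [← Algebra.smul_def]
  -- This is the hypothesis with `ε` applied to the left leg, where the counit law collapses `(ε ⊗
  -- id)Δθ` to `θ`.
  have h2 : Coalgebra.counit.rTensor B ∘ₗ TensorProduct.map θ LinearMap.id ∘ₗ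
      Coalgebra.comul (R := k) (A := B) = TensorProduct.mk k k B 1 ∘ₗ θ := by
    rw [← h, ← LinearMap.comp_assoc, Coalgebra.rTensor_counit_comp_comul]
  refine WithConv.ext (LinearMap.ext fun x => ?_)
  refine (LinearMap.congr_fun h1 (Coalgebra.comul x)).trans ?_
  have := LinearMap.congr_fun h2 x
  simp only [LinearMap.comp_apply] at this ⊢
  rw [this]
  simp

/-- If `Δθ = (id ⊗ θ)Δ`, then `f ∘ θ = f * (ε ∘ θ)`. -/
theorem mul_scalarConv {θ : B →ₗ[k] B}
    (h : Coalgebra.comul ∘ₗ θ = TensorProduct.map LinearMap.id θ ∘ₗ Coalgebra.comul (R := k))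
    (f : B →ₗ[k] A) : toConv f * scalarConv A (Coalgebra.counit ∘ₗ θ) = toConv (f ∘ₗ θ) := by
  have h1 : LinearMap.mul' k A ∘ₗ
      TensorProduct.map f (Algebra.linearMap k A ∘ₗ Coalgebra.counit ∘ₗ θ) =
      f ∘ₗ (TensorProduct.rid k B).toLinearMap ∘ₗ Coalgebra.counit.lTensor B ∘ₗ
        TensorProduct.map LinearMap.id θ := by
    ext; simp [← Algebra.commutes, ← Algebra.smul_def]
  have h2 : Coalgebra.counit.lTensor B ∘ₗ TensorProduct.map LinearMap.id θ ∘ₗ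
      Coalgebra.comul (R := k) (A := B) = (TensorProduct.mk k B k).flip 1 ∘ₗ θ := by
    rw [← h, ← LinearMap.comp_assoc, Coalgebra.lTensor_counit_comp_comul]
  refine WithConv.ext (LinearMap.ext fun x => ?_)
  refine (LinearMap.congr_fun h1 (Coalgebra.comul x)).trans ?_
  have := LinearMap.congr_fun h2 x
  simp only [LinearMap.comp_apply] at this ⊢
  rw [this]
  simp

/-- The comultiplication is the convolution product of the two inclusions. -/
theorem toConv_map_comul (f g : B →ₗ[k] B) :
    toConv (TensorProduct.map f g ∘ₗ Coalgebra.comul (R := k) (A := B)) =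
      toConv ((Algebra.TensorProduct.includeLeft : B →ₐ[k] B ⊗[k] B).toLinearMap ∘ₗ f) *
      toConv ((Algebra.TensorProduct.includeRight : B →ₐ[k] B ⊗[k] B).toLinearMap ∘ₗ g) := by
  have : TensorProduct.map f g = LinearMap.mul' k (B ⊗[k] B) ∘ₗ
      TensorProduct.map ((Algebra.TensorProduct.includeLeft : B →ₐ[k] B ⊗[k] B).toLinearMap ∘ₗ f)
        ((Algebra.TensorProduct.includeRight : B →ₐ[k] B ⊗[k] B).toLinearMap ∘ₗ g) := by
    ext; simp
  rw [this]; rfl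

/-- Convolution of scalar functionals, in any algebra. -/
theorem scalarConv_mul_scalarConv (f g : B →ₗ[k] k) :
    scalarConv A f * scalarConv A g = scalarConv A (toConv f * toConv g).ofConv := by
  have := LinearMap.algHom_comp_convMul_distrib (Algebra.ofId k A) (toConv f) (toConv g)
  exact (congrArg toConv this).symm

namespace IsTwistingPair

variable {φ₁ φ₂ : B ≃ₐ[k] B} (h : IsTwistingPair φ₁ φ₂)
include h

/-- For `f = id` this exhibits `φ₁` as right translation by the functional `ε ∘ φ₁`. -/
theorem toConv_comp_fst (f : B →ₗ[k] A) : toConv (f ∘ₗ φ₁.toLinearMap) =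
    toConv f * scalarConv A (Coalgebra.counit ∘ₗ φ₁.toLinearMap) :=
  (mul_scalarConv h.comul_fst f).symm

theorem toConv_comp_snd (f : B →ₗ[k] A) : toConv (f ∘ₗ φ₂.toLinearMap) =
    scalarConv A (Coalgebra.counit ∘ₗ φ₂.toLinearMap) * toConv f :=
  (scalarConv_mul h.comul_snd f).symm

/-- A left translation and a right translation commute by associativity of convolution. -/
theorem commute : Commute φ₁ φ₂ := by
  have h1 := h.toConv_comp_fst φ₂.toLinearMap
  have h2 := h.toConv_comp_snd φ₁.toLinearMap
  have h3 := h.toConv_comp_snd (LinearMap.id (R := k) (M := B))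
  have h4 := h.toConv_comp_fst (LinearMap.id (R := k) (M := B))
  rw [LinearMap.id_comp] at h3 h4
  rw [h3, mul_assoc, ← h4, ← h2] at h1
  exact AlgEquiv.ext fun x => (LinearMap.congr_fun (congrArg ofConv h1) x).symm

theorem counit_mul_pow (n : ℤ) (x : B) :
    Coalgebra.counit (R := k) ((((φ₁ * φ₂) ^ n : B ≃ₐ[k] B)) x) = Coalgebra.counit (R := k) x := by
  induction n generalizing x with
  | zero => simp
  | succ n ih => rw [zpow_add_one, AlgEquiv.mul_apply, ih]; exact h.counit_comp x
  | pred n ih =>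
    have := ih ((φ₁ * φ₂)⁻¹ x)
    rw [zpow_sub_one, AlgEquiv.mul_apply, this, ← h.counit_comp]
    exact congrArg _ (AlgEquiv.apply_symm_apply (φ₁ * φ₂) x)

/-- Since `φ₁` and `φ₂` commute, `φ₁ⁿ = (φ₁φ₂)ⁿ φ₂⁻ⁿ`, and `ε` is invariant under `(φ₁φ₂)ⁿ`. All
functionals that occur are thereby of the form `ε ∘ φ₂ᵐ`. -/
theorem counit_snd_pow_neg (n : ℤ) (x : B) :
    Coalgebra.counit (R := k) ((φ₂ ^ (-n)) x) = Coalgebra.counit (R := k) ((φ₁ ^ n) x) := by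
  have := h.counit_mul_pow n ((φ₂ ^ (-n)) x)
  rw [h.commute.mul_zpow, ← AlgEquiv.mul_apply, mul_assoc, ← zpow_add, add_neg_cancel, zpow_zero,
    mul_one] at this
  exact this.symm

theorem comul_snd_zpow (n : ℤ) : Coalgebra.comul ∘ₗ (φ₂ ^ n).toLinearMap =
    TensorProduct.map (φ₂ ^ n).toLinearMap LinearMap.id ∘ₗ Coalgebra.comul (R := k) (A := B) := by
  have h1 : ∀ x, Coalgebra.comul (R := k) (φ₂ x) =
      (Algebra.TensorProduct.congr φ₂ (.refl : B ≃ₐ[k] B)) (Coalgebra.comul x) :=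
    fun x => LinearMap.congr_fun h.comul_snd x
  -- Negative powers need the relation for the inverse, obtained by cancelling the invertible map
  -- `φ₂ ⊗ id`.
  have h2 : ∀ x, Coalgebra.comul (R := k) (φ₂⁻¹ x) =
      (Algebra.TensorProduct.congr φ₂ (.refl : B ≃ₐ[k] B)).symm (Coalgebra.comul x) := fun x => by
    rw [AlgEquiv.eq_symm_apply, ← h1]
    exact congrArg _ (AlgEquiv.apply_symm_apply φ₂ x)
  induction n with
  | zero => exact (LinearMap.id_comp _).symm.trans (by rw [← TensorProduct.map_id]; rfl)
  | succ n ih =>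
    have e : (φ₂ ^ ((n : ℤ) + 1)).toLinearMap =
        (φ₂ ^ (n : ℤ)).toLinearMap ∘ₗ φ₂.toLinearMap := by rw [zpow_add_one]; rfl
    rw [e, ← LinearMap.comp_assoc, ih, LinearMap.comp_assoc, h.comul_snd, ← LinearMap.comp_assoc,
      ← TensorProduct.map_comp, LinearMap.id_comp]
  | pred n ih =>
    have e : (φ₂ ^ (-(n : ℤ) - 1)).toLinearMap =
        (φ₂ ^ (-(n : ℤ))).toLinearMap ∘ₗ (φ₂⁻¹).toLinearMap := by rw [zpow_sub_one]; rfl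
    have h3 : Coalgebra.comul (R := k) ∘ₗ (φ₂⁻¹).toLinearMap =
      TensorProduct.map (φ₂⁻¹).toLinearMap LinearMap.id ∘ₗ Coalgebra.comul := LinearMap.ext h2
    rw [e, ← LinearMap.comp_assoc, ih, LinearMap.comp_assoc, h3, ← LinearMap.comp_assoc,
      ← TensorProduct.map_comp, LinearMap.id_comp]

/-- Convolution with `ε ∘ φ₂ⁿ` from the left. -/
theorem counit_snd_zpow_mul (n : ℤ) (f : B →ₗ[k] A) :
    scalarConv A (Coalgebra.counit ∘ₗ (φ₂ ^ n).toLinearMap) * toConv f =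
      toConv (f ∘ₗ (φ₂ ^ n).toLinearMap) :=
  scalarConv_mul (h.comul_snd_zpow n) f

/-- Left convolution with `ε ∘ φ₂ᵐ` is precomposition with `φ₂ᵐ`, so the functionals `ε ∘ φ₂ⁿ` form
a one-parameter group. Invertibility of `σ` and the cocycle identity both reduce to this. -/
theorem counit_snd_zpow_add (m n : ℤ) :
    toConv (Coalgebra.counit (R := k) ∘ₗ (φ₂ ^ m).toLinearMap) *
      toConv (Coalgebra.counit (R := k) ∘ₗ (φ₂ ^ n).toLinearMap) =
    toConv (Coalgebra.counit (R := k) ∘ₗ (φ₂ ^ (m + n)).toLinearMap) := by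
  refine (h.counit_snd_zpow_mul m (Coalgebra.counit ∘ₗ (φ₂ ^ n).toLinearMap)).trans ?_
  rw [add_comm, zpow_add]
  rfl

theorem comul_fst_zpow (n : ℤ) : Coalgebra.comul ∘ₗ (φ₁ ^ n).toLinearMap =
    TensorProduct.map LinearMap.id (φ₁ ^ n).toLinearMap ∘ₗ Coalgebra.comul (R := k) (A := B) := by
  have h1 : ∀ x, Coalgebra.comul (R := k) (φ₁ x) =
      (Algebra.TensorProduct.congr (.refl : B ≃ₐ[k] B) φ₁) (Coalgebra.comul x) :=
    fun x => LinearMap.congr_fun h.comul_fst x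
  have h2 : ∀ x, Coalgebra.comul (R := k) (φ₁⁻¹ x) =
      (Algebra.TensorProduct.congr (.refl : B ≃ₐ[k] B) φ₁).symm (Coalgebra.comul x) := fun x => by
    rw [AlgEquiv.eq_symm_apply, ← h1]
    exact congrArg _ (AlgEquiv.apply_symm_apply φ₁ x)
  induction n with
  | zero => exact (LinearMap.id_comp _).symm.trans (by rw [← TensorProduct.map_id]; rfl)
  | succ n ih =>
    have e : (φ₁ ^ ((n : ℤ) + 1)).toLinearMap =
        (φ₁ ^ (n : ℤ)).toLinearMap ∘ₗ φ₁.toLinearMap := by rw [zpow_add_one]; rfl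
    rw [e, ← LinearMap.comp_assoc, ih, LinearMap.comp_assoc, h.comul_fst, ← LinearMap.comp_assoc,
      ← TensorProduct.map_comp, LinearMap.id_comp]
  | pred n ih =>
    have e : (φ₁ ^ (-(n : ℤ) - 1)).toLinearMap =
        (φ₁ ^ (-(n : ℤ))).toLinearMap ∘ₗ (φ₁⁻¹).toLinearMap := by rw [zpow_sub_one]; rfl
    have h3 : Coalgebra.comul (R := k) ∘ₗ (φ₁⁻¹).toLinearMap =
      TensorProduct.map LinearMap.id (φ₁⁻¹).toLinearMap ∘ₗ Coalgebra.comul := LinearMap.ext h2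
    rw [e, ← LinearMap.comp_assoc, ih, LinearMap.comp_assoc, h3, ← LinearMap.comp_assoc,
      ← TensorProduct.map_comp, LinearMap.id_comp]

/-- Convolution with `ε ∘ φ₂⁻ⁿ` from the right. -/
theorem mul_counit_snd_zpow_neg (n : ℤ) (f : B →ₗ[k] A) :
    toConv f * scalarConv A (Coalgebra.counit ∘ₗ (φ₂ ^ (-n)).toLinearMap) =
      toConv (f ∘ₗ (φ₁ ^ n).toLinearMap) := by
  rw [← mul_scalarConv (h.comul_fst_zpow n) f]
  congr 2
  exact LinearMap.ext (h.counit_snd_pow_neg n)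

/-- The two functionals are the members of exponent `-1` and `1` of the group `n ↦ ε ∘ φ₂ⁿ`. -/
theorem conv_counit_fst_snd :
    toConv (Coalgebra.counit (R := k) ∘ₗ φ₁.toLinearMap) *
      toConv (Coalgebra.counit (R := k) ∘ₗ φ₂.toLinearMap) = 1 := by
  have h1 := h.counit_snd_zpow_add (-1) 1
  have h2 : Coalgebra.counit ∘ₗ (φ₂ ^ (-1 : ℤ)).toLinearMap =
      Coalgebra.counit (R := k) ∘ₗ φ₁.toLinearMap :=
    LinearMap.ext fun x => by simpa using h.counit_snd_pow_neg 1 x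
  rw [h2, zpow_one, neg_add_cancel, zpow_zero] at h1
  exact h1

theorem conv_counit_snd_fst :
    toConv (Coalgebra.counit (R := k) ∘ₗ φ₂.toLinearMap) *
      toConv (Coalgebra.counit (R := k) ∘ₗ φ₁.toLinearMap) = 1 := by
  have h1 := h.counit_snd_zpow_add 1 (-1)
  have h2 : Coalgebra.counit ∘ₗ (φ₂ ^ (-1 : ℤ)).toLinearMap =
      Coalgebra.counit (R := k) ∘ₗ φ₁.toLinearMap :=
    LinearMap.ext fun x => by simpa using h.counit_snd_pow_neg 1 x
  rw [h2, zpow_one, add_neg_cancel, zpow_zero] at h1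
  exact h1

/-- With `Δ` written as the convolution of the two inclusions, `φ₁` inserts `ε ∘ φ₁` to the right of
the first and `φ₂` inserts `ε ∘ φ₂` to the left of the second; these meet in the middle and cancel.
-/
theorem map_comul_fst_snd : TensorProduct.map φ₁.toLinearMap φ₂.toLinearMap ∘ₗ Coalgebra.comul =
    Coalgebra.comul (R := k) (A := B) := by
  apply toConv_injective
  have h1 := toConv_map_comul (k := k) (B := B) LinearMap.id LinearMap.id
  rw [TensorProduct.map_id, LinearMap.id_comp] at h1
  rw [toConv_map_comul, h.toConv_comp_fst, h.toConv_comp_snd, mul_assoc, ← mul_assoc (scalarConv _ _),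
    scalarConv_mul_scalarConv, h.conv_counit_fst_snd, h1]
  exact congrArg _ (one_mul _)

theorem comul_fst_snd (x : B) : Coalgebra.comul (R := k) (φ₁ (φ₂ x)) =
    TensorProduct.map (φ₁ * φ₂).toLinearMap (φ₁ * φ₂).toLinearMap (Coalgebra.comul x) := by
  have e : (φ₁ * φ₂).toLinearMap = φ₂.toLinearMap ∘ₗ φ₁.toLinearMap := by rw [h.commute.eq]; rfl
  have e' : (φ₁ * φ₂).toLinearMap = φ₁.toLinearMap ∘ₗ φ₂.toLinearMap := rfl
  -- With the first leg written as `φ₂φ₁` and the second as `φ₁φ₂`, the map factors as `(φ₂ ⊗ φ₁)(φ₁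
  -- ⊗ φ₂)`; the right factor fixes `Δ(x)`.
  nth_rw 1 [e]
  rw [e', TensorProduct.map_comp, LinearMap.comp_apply]
  have h1 := LinearMap.congr_fun h.map_comul_fst_snd x
  have h2 := LinearMap.congr_fun h.comul_fst (φ₂ x)
  have h3 := LinearMap.congr_fun h.comul_snd x
  simp only [LinearMap.comp_apply, AlgEquiv.toLinearMap_apply] at h1 h2 h3
  rw [h1, h2, h3, ← LinearMap.comp_apply (TensorProduct.map _ _), ← TensorProduct.map_comp,
    LinearMap.id_comp, LinearMap.comp_id]

end IsTwistingPair
end TwistingPair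

/-! ### Gradings by `ℤ` as coactions of its group algebra. -/

section Grading

variable {k A M : Type*} [Field k] [Ring A] [Algebra k A] [AddCommGroup M] [Module k M]

theorem homogeneous_induction {𝓐 : ℤ → Submodule k A} (h𝓐 : DirectSum.IsInternal 𝓐) {P : A → Prop}
    (mem : ∀ n, ∀ x ∈ 𝓐 n, P x) (add : ∀ x y, P x → P y → P (x + y)) (x : A) : P x := by
  have hx : x ∈ ⨆ n, 𝓐 n := by rw [h𝓐.submodule_iSup_eq_top]; trivial
  exact Submodule.iSup_induction 𝓐 (motive := P) hx mem (mem 0 0 (Submodule.zero_mem _)) add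

theorem homogeneous_ext {𝓐 : ℤ → Submodule k A} (h𝓐 : DirectSum.IsInternal 𝓐) {f g : A →ₗ[k] M}
    (h : ∀ n, ∀ x ∈ 𝓐 n, f x = g x) : f = g :=
  LinearMap.ext (homogeneous_induction h𝓐 h fun x y hx hy => by rw [map_add, map_add, hx, hy])

/-- The linear map that is `f n` on the homogeneous component of degree `n`. -/
noncomputable def homogeneousLift (𝓐 : ℤ → Submodule k A) (h𝓐 : DirectSum.IsInternal 𝓐)
    (f : ℤ → A →ₗ[k] M) : A →ₗ[k] M :=
  DirectSum.toModule k ℤ M (fun n => f n ∘ₗ (𝓐 n).subtype) ∘ₗ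
    (LinearEquiv.ofBijective (DirectSum.coeLinearMap 𝓐) h𝓐).symm.toLinearMap

theorem homogeneousLift_apply {𝓐 : ℤ → Submodule k A} (h𝓐 : DirectSum.IsInternal 𝓐)
    (f : ℤ → A →ₗ[k] M) {n : ℤ} {x : A} (hx : x ∈ 𝓐 n) : homogeneousLift 𝓐 h𝓐 f x = f n x := by
  have : (LinearEquiv.ofBijective (DirectSum.coeLinearMap 𝓐) h𝓐).symm x =
      DirectSum.lof k ℤ (fun n => 𝓐 n) n ⟨x, hx⟩ := by
    rw [LinearEquiv.symm_apply_eq]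
    exact (DirectSum.coeLinearMap_lof 𝓐 n ⟨x, hx⟩).symm
  rw [homogeneousLift, LinearMap.comp_apply, LinearEquiv.coe_coe, this, DirectSum.toModule_lof]
  rfl

/-- The coefficient of `Tⁿ`, as a linear map. -/
noncomputable def coeffLinear (k : Type*) [Field k] {A : Type*} [Ring A] [Algebra k A] (n : ℤ) :
    AddMonoidAlgebra A ℤ →ₗ[k] A :=
  Finsupp.lapply n ∘ₗ (AddMonoidAlgebra.coeffLinearEquiv k).toLinearMap

theorem coeffLinear_apply (n : ℤ) (x : AddMonoidAlgebra A ℤ) :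
    coeffLinear k n x = x.coeff n := rfl

/-- The coaction `x ↦ x T^{|x|}` of a grading. -/
noncomputable def gradingCoaction (𝓐 : ℤ → Submodule k A) (hm : SetLike.GradedMonoid 𝓐)
    (h𝓐 : DirectSum.IsInternal 𝓐) : A →ₐ[k] AddMonoidAlgebra A ℤ :=
  AlgHom.ofLinearMap (homogeneousLift 𝓐 h𝓐 fun n => AddMonoidAlgebra.lsingle n)
    (by
      rw [homogeneousLift_apply h𝓐 _ (n := 0) hm.one_mem]
      rfl)
    (fun x y => by
      induction x using homogeneous_induction h𝓐 with
      | add x x' hx hx' => simp only [add_mul, map_add, hx, hx']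
      | mem n x hx =>
        induction y using homogeneous_induction h𝓐 with
        | add x x' hx hx' => simp only [mul_add, map_add, hx, hx']
        | mem m y hy =>
          rw [homogeneousLift_apply h𝓐 _ hx, homogeneousLift_apply h𝓐 _ hy,
            homogeneousLift_apply h𝓐 _ (hm.mul_mem hx hy)]
          simp [AddMonoidAlgebra.single_mul_single, -LaurentPolynomial.single_eq_C_mul_T])

theorem gradingCoaction_apply {𝓐 : ℤ → Submodule k A} (hm : SetLike.GradedMonoid 𝓐)
    (h𝓐 : DirectSum.IsInternal 𝓐) {n : ℤ} {x : A} (hx : x ∈ 𝓐 n) :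
    gradingCoaction 𝓐 hm h𝓐 x = AddMonoidAlgebra.single n x :=
  homogeneousLift_apply h𝓐 _ hx

/-- The coaction remembers the grading, so questions about gradings become equalities of algebra
maps. For the converse direction, the coefficient of `Tⁿ` always lies in degree `n`, and here it is
`x` itself. -/
theorem mem_iff_gradingCoaction {𝓐 : ℤ → Submodule k A} (hm : SetLike.GradedMonoid 𝓐)
    (h𝓐 : DirectSum.IsInternal 𝓐) {n : ℤ} {x : A} :
    x ∈ 𝓐 n ↔ gradingCoaction 𝓐 hm h𝓐 x = AddMonoidAlgebra.single n x := by
  refine ⟨gradingCoaction_apply hm h𝓐, fun h => ?_⟩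
  have key : (gradingCoaction 𝓐 hm h𝓐 x).coeff n ∈ 𝓐 n := by
    clear h
    induction x using homogeneous_induction h𝓐 with
    | add x y hx hy => simpa using add_mem hx hy
    | mem m x hx =>
      rw [gradingCoaction_apply hm h𝓐 hx, AddMonoidAlgebra.coeff_single, Finsupp.single_apply]
      split_ifs with e
      · exact e ▸ hx
      · exact zero_mem _
  rw [h] at key
  simpa [-LaurentPolynomial.single_eq_C_mul_T] using key

/-- The homogeneous components of a coaction of the group algebra of `ℤ`. -/
noncomputable def coactionGrading (ρ : A →ₐ[k] AddMonoidAlgebra A ℤ) (n : ℤ) : Submodule k A :=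
  LinearMap.eqLocus ρ.toLinearMap (AddMonoidAlgebra.lsingle n)

theorem mem_coactionGrading {ρ : A →ₐ[k] AddMonoidAlgebra A ℤ} {n : ℤ} {x : A} :
    x ∈ coactionGrading ρ n ↔ ρ x = AddMonoidAlgebra.single n x := Iff.rfl

theorem coactionGrading_gradedMonoid (ρ : A →ₐ[k] AddMonoidAlgebra A ℤ) :
    SetLike.GradedMonoid (coactionGrading ρ) where
  one_mem := by rw [mem_coactionGrading, map_one]; rfl
  mul_mem m n x y hx hy := by
    rw [mem_coactionGrading] at *
    rw [map_mul, hx, hy, AddMonoidAlgebra.single_mul_single]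

/-- The hypotheses are the counit law and coassociativity of a comodule, read off on coefficients.
The coefficients of `ρ x` are the homogeneous components of `x`: they recover the summands, which
gives injectivity, and they add up to `x`, which gives surjectivity. -/
theorem coactionGrading_isInternal (ρ : A →ₐ[k] AddMonoidAlgebra A ℤ)
    (hsum : ∀ x, (ρ x).coeff.sum (fun _ a => a) = x)
    (hmem : ∀ n x, (ρ x).coeff n ∈ coactionGrading ρ n) :
    DirectSum.IsInternal (coactionGrading ρ) := by
  have key : ∀ v : DirectSum ℤ (fun n => coactionGrading ρ n), ∀ n,
      (ρ (DirectSum.coeLinearMap (coactionGrading ρ) v)).coeff n = v n := by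
    intro v n
    induction v using DirectSum.induction_on with
    | zero => simp
    | add v w hv hw => simp [hv, hw]
    | of m x =>
      have h := DirectSum.coeLinearMap_lof (coactionGrading ρ) m x
      rw [DirectSum.lof_eq_of] at h
      rw [h, mem_coactionGrading.1 x.2, AddMonoidAlgebra.coeff_single]
      by_cases e : m = n
      · subst e; simp
      · rw [Finsupp.single_eq_of_ne (Ne.symm e), DirectSum.of_eq_of_ne _ _ _ (Ne.symm e)]
        rfl
  refine ⟨fun v w h => DFinsupp.ext fun n => Subtype.ext ?_, fun x => ?_⟩
  · rw [← key v, ← key w]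
    exact congrArg (fun x => (ρ x).coeff n) h
  · refine ⟨∑ n ∈ (ρ x).coeff.support, DirectSum.lof k ℤ (fun n => coactionGrading ρ n) n
      ⟨_, hmem n x⟩, ?_⟩
    refine (map_sum (DirectSum.coeLinearMap (coactionGrading ρ)) _ _).trans ?_
    simp only [DirectSum.coeLinearMap_lof]
    exact hsum x

/-- The sum of the coefficients. -/
noncomputable def sumCoeff (k A : Type*) [Field k] [Ring A] [Algebra k A] :
    AddMonoidAlgebra A ℤ →ₐ[k] A :=
  AddMonoidAlgebra.liftNCAlgHom (AlgHom.id k A) 1 fun _ _ => Commute.one_right _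

theorem sumCoeff_single (n : ℤ) (x : A) :
    sumCoeff k A (AddMonoidAlgebra.single n x) = x := by
  simp [sumCoeff, -LaurentPolynomial.single_eq_C_mul_T]

theorem sumCoeff_apply (x : AddMonoidAlgebra A ℤ) :
    sumCoeff k A x = x.coeff.sum (fun _ a => a) := by
  induction x using AddMonoidAlgebra.induction_linear with
  | zero => simp
  | add x y hx hy => rw [map_add, hx, hy, AddMonoidAlgebra.coeff_add, Finsupp.sum_add_index'] <;> simp
  | single n x => rw [sumCoeff_single]; simp [-LaurentPolynomial.single_eq_C_mul_T]

/-- The algebra map `a Tⁿ ↦ (a Tⁿ) Tⁿ`. -/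
noncomputable def diagCoeff (k A : Type*) [Field k] [Ring A] [Algebra k A] :
    AddMonoidAlgebra A ℤ →ₐ[k] AddMonoidAlgebra (AddMonoidAlgebra A ℤ) ℤ :=
  AddMonoidAlgebra.liftNCAlgHom
    (AddMonoidAlgebra.singleZeroAlgHom.comp AddMonoidAlgebra.singleZeroAlgHom)
    { toFun := fun n => AddMonoidAlgebra.single n.toAdd (AddMonoidAlgebra.single n.toAdd 1)
      map_one' := rfl
      map_mul' := fun m n => by simp [AddMonoidAlgebra.single_mul_single, -LaurentPolynomial.single_eq_C_mul_T] } fun x n => by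
    simp [-LaurentPolynomial.single_eq_C_mul_T, Commute, SemiconjBy, AddMonoidAlgebra.single_mul_single]

theorem diagCoeff_single (n : ℤ) (x : A) : diagCoeff k A (AddMonoidAlgebra.single n x) =
    AddMonoidAlgebra.single n (AddMonoidAlgebra.single n x) := by
  refine (AddMonoidAlgebra.liftNC_single _ _ _ _).trans ?_
  simp [AddMonoidAlgebra.single_mul_single, -LaurentPolynomial.single_eq_C_mul_T]

theorem coeff_diagCoeff (n : ℤ) (x : AddMonoidAlgebra A ℤ) :
    (diagCoeff k A x).coeff n = AddMonoidAlgebra.single n (x.coeff n) := by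
  induction x using AddMonoidAlgebra.induction_linear with
  | zero => simp
  | add x y hx hy => simp [hx, hy]
  | single m x =>
    rw [diagCoeff_single, AddMonoidAlgebra.coeff_single, AddMonoidAlgebra.coeff_single]
    by_cases h : m = n
    · subst h; simp [-LaurentPolynomial.single_eq_C_mul_T]
    · simp [h, -LaurentPolynomial.single_eq_C_mul_T]

end Grading

/-! ### Translations by characters, restricted to a bialgebra mapping to `H`. -/

section Translation

variable {k B H : Type*} [Field k] [Ring B] [Bialgebra k B] [Ring H] [Bialgebra k H]

/-- The algebra map `x ↦ ∑ x₁ α(x₂)`. -/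
noncomputable def rightTranslate (α : H →ₐ[k] k) : H →ₐ[k] H :=
  (Algebra.TensorProduct.rid k k H : H ⊗[k] k →ₐ[k] H).comp
    ((Algebra.TensorProduct.map (.id k H) α).comp (Bialgebra.comulAlgHom k H))

/-- The algebra map `x ↦ ∑ α(x₁) x₂`. -/
noncomputable def leftTranslate (α : H →ₐ[k] k) : H →ₐ[k] H :=
  (Algebra.TensorProduct.lid k H : k ⊗[k] H →ₐ[k] H).comp
    ((Algebra.TensorProduct.map α (.id k H)).comp (Bialgebra.comulAlgHom k H))

theorem comul_bialgHom (i : B →ₐc[k] H) (b : B) : Coalgebra.comul (R := k) (i b) =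
    TensorProduct.map (i : B →ₐ[k] H).toLinearMap (i : B →ₐ[k] H).toLinearMap
      (Coalgebra.comul b) :=
  (CoalgHomClass.map_comp_comul_apply i b).symm

/-- As `i` respects `Δ`, translation on the image of `i` is a convolution over `B`, in which only
the restriction of `α` to `B` enters. -/
theorem rightTranslate_bialgHom (α : H →ₐ[k] k) (i : B →ₐc[k] H) (b : B) :
    rightTranslate α (i b) = (toConv (i : B →ₐ[k] H).toLinearMap *
      scalarConv H (α.comp (i : B →ₐ[k] H)).toLinearMap).ofConv b := by
  have h : ((Algebra.TensorProduct.rid k k H : H ⊗[k] k →ₐ[k] H).comp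
      (Algebra.TensorProduct.map (.id k H) α)).toLinearMap ∘ₗ
        TensorProduct.map (i : B →ₐ[k] H).toLinearMap (i : B →ₐ[k] H).toLinearMap =
      LinearMap.mul' k H ∘ₗ TensorProduct.map (i : B →ₐ[k] H).toLinearMap
        (Algebra.linearMap k H ∘ₗ (α.comp (i : B →ₐ[k] H)).toLinearMap) := by
    ext; simp [← Algebra.commutes, ← Algebra.smul_def]
  have := LinearMap.congr_fun h (Coalgebra.comul b)
  rw [LinearMap.comp_apply, ← comul_bialgHom] at this
  exact this

theorem leftTranslate_bialgHom (α : H →ₐ[k] k) (i : B →ₐc[k] H) (b : B) :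
    leftTranslate α (i b) = (scalarConv H (α.comp (i : B →ₐ[k] H)).toLinearMap *
      toConv (i : B →ₐ[k] H).toLinearMap).ofConv b := by
  have h : ((Algebra.TensorProduct.lid k H : k ⊗[k] H →ₐ[k] H).comp
      (Algebra.TensorProduct.map α (.id k H))).toLinearMap ∘ₗ
        TensorProduct.map (i : B →ₐ[k] H).toLinearMap (i : B →ₐ[k] H).toLinearMap =
      LinearMap.mul' k H ∘ₗ TensorProduct.map
        (Algebra.linearMap k H ∘ₗ (α.comp (i : B →ₐ[k] H)).toLinearMap)
        (i : B →ₐ[k] H).toLinearMap := by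
    ext; simp [← Algebra.smul_def]
  have := LinearMap.congr_fun h (Coalgebra.comul b)
  rw [LinearMap.comp_apply, ← comul_bialgHom] at this
  exact this

end Translation

/-! ### Extending maps, characters, twisting pairs and coactions to the Hopf envelope. -/

namespace IsHopfEnvelope

variable {k B H : Type u} [Field k] [Ring B] [Bialgebra k B] [Ring H] [HopfAlgebra k H]
  {i : B →ₐc[k] H} (hi : IsHopfEnvelope i)
include hi

/-- A Hopf envelope is a retract of the one constructed by generators and relations. -/
theorem exists_retraction : ∃ (f : H →ₐc[k] HopfEnvelope.Env k B)
    (g : HopfEnvelope.Env k B →ₐc[k] H), (∀ b, f (i b) = HopfEnvelope.of k B b) ∧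
      (∀ b, g (HopfEnvelope.of k B b) = i b) ∧ ∀ x, g (f x) = x := by
  obtain ⟨f, hf, -⟩ := hi _ (HopfEnvelope.of k B)
  obtain ⟨g, hg, -⟩ := HopfEnvelope.isHopfEnvelope k B H i
  obtain ⟨e, -, he⟩ := hi H i
  refine ⟨f, g, fun b => DFunLike.congr_fun hf b, fun b => DFunLike.congr_fun hg b, fun x => ?_⟩
  -- Both `g ∘ f` and the identity extend `i`, so the uniqueness clause identifies them.
  have h1 : g.comp f = e := he _ (by
    refine BialgHom.ext fun b => ?_
    have := DFunLike.congr_fun hf b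
    exact (congrArg g this).trans (DFunLike.congr_fun hg b))
  have h2 : BialgHom.id k H = e := he _ (BialgHom.ext fun b => rfl)
  exact DFunLike.congr_fun (h1.trans h2.symm) x

/-- Algebra maps out of a Hopf envelope are determined by their restriction to the bialgebra. -/
theorem algHom_ext {A : Type*} [Ring A] [Algebra k A] {φ ψ : H →ₐ[k] A}
    (h : ∀ b, φ (i b) = ψ (i b)) : φ = ψ := by
  obtain ⟨f, g, -, hg, hgf⟩ := hi.exists_retraction
  -- The universal property controls only bialgebra maps. For arbitrary algebra maps the comparison
  -- is made on the presented envelope and carried back along the retraction.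
  have : φ.comp (g : HopfEnvelope.Env k B →ₐ[k] H) = ψ.comp (g : HopfEnvelope.Env k B →ₐ[k] H) :=
    HopfEnvelope.hom_ext fun b => by
      have h1 : g (HopfEnvelope.e k B 0 b) = i b := hg b
      simpa [h1] using h b
  refine AlgHom.ext fun x => ?_
  have h2 := AlgHom.congr_fun this (f x)
  simpa [hgf] using h2

theorem algEquiv_ext {φ ψ : H ≃ₐ[k] H} (h : ∀ b, φ (i b) = ψ (i b)) : φ = ψ := by
  have : (φ : H →ₐ[k] H) = ψ := hi.algHom_ext h
  exact AlgEquiv.ext fun x => AlgHom.congr_fun this x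

/-- A convolution invertible character extends to the Hopf envelope. -/
theorem exists_character (α β : B →ₐ[k] k) (h₁ : toConv α.toLinearMap * toConv β.toLinearMap = 1)
    (h₂ : toConv β.toLinearMap * toConv α.toLinearMap = 1) :
    ∃ γ : H →ₐ[k] k, ∀ b, γ (i b) = α b := by
  obtain ⟨f, -, hf, -, -⟩ := hi.exists_retraction
  have c₁ : HopfEnvelope.conv α.toLinearMap β.toLinearMap = HopfEnvelope.cone k B k :=
    congrArg ofConv h₁
  have c₂ : HopfEnvelope.conv β.toLinearMap α.toLinearMap = HopfEnvelope.cone k B k :=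
    congrArg ofConv h₂
  -- Commutativity of `k` turns the opposite convolution relations into the ordinary ones.
  have c₃ : ∀ f g : B →ₗ[k] k, HopfEnvelope.convCop f g = HopfEnvelope.conv g f := fun f g => by
    have : LinearMap.mul' k k ∘ₗ TensorProduct.map f g ∘ₗ (TensorProduct.comm k B B).toLinearMap =
        LinearMap.mul' k k ∘ₗ TensorProduct.map g f := by
      ext; simp [mul_comm]
    exact congrArg (fun F => F ∘ₗ Coalgebra.comul) this
  -- Composing a character with the antipode inverts it, so the values on the successive copies of
  -- `B` alternate between `α` and `β`.
  have hF : HopfEnvelope.IsFamily (fun _ : ℕ => α.toLinearMap) (fun _ => β.toLinearMap) :=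
    ⟨by simp, by simp, by simp, by simp [mul_comm], fun _ => c₁, fun _ => c₂,
      fun _ => (c₃ _ _).trans c₁, fun _ => (c₃ _ _).trans c₂⟩
  refine ⟨(HopfEnvelope.lift hF).comp (f : H →ₐ[k] HopfEnvelope.Env k B), fun b => ?_⟩
  have : HopfEnvelope.lift hF (HopfEnvelope.of k B b) = α b := HopfEnvelope.lift_e hF 0 b
  rw [← hf] at this
  exact this

/-- A twisting pair extends to the Hopf envelope. -/
theorem exists_isTwistingPair {φ₁ φ₂ : B ≃ₐ[k] B} (hφ : IsTwistingPair φ₁ φ₂) :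
    ∃ Φ₁ Φ₂ : H ≃ₐ[k] H, IsTwistingPair Φ₁ Φ₂ ∧ (∀ b, Φ₁ (i b) = i (φ₁ b)) ∧
      ∀ b, Φ₂ (i b) = i (φ₂ b) := by
  obtain ⟨α, hα⟩ := hi.exists_character ((Bialgebra.counitAlgHom k B).comp φ₁)
    ((Bialgebra.counitAlgHom k B).comp φ₂) hφ.conv_counit_fst_snd hφ.conv_counit_snd_fst
  obtain ⟨β, hβ⟩ := hi.exists_character ((Bialgebra.counitAlgHom k B).comp φ₂)
    ((Bialgebra.counitAlgHom k B).comp φ₁) hφ.conv_counit_snd_fst hφ.conv_counit_fst_snd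
  have eα : (α.comp (i : B →ₐ[k] H)).toLinearMap = Coalgebra.counit ∘ₗ φ₁.toLinearMap :=
    LinearMap.ext hα
  have eβ : (β.comp (i : B →ₐ[k] H)).toLinearMap = Coalgebra.counit ∘ₗ φ₂.toLinearMap :=
    LinearMap.ext hβ
  -- Writing the functionals as powers of exponent `-1` and `-(-1)` lets the translation formulas
  -- also produce `φ₁⁻¹` and `φ₂⁻¹`.
  have eα' : (α.comp (i : B →ₐ[k] H)).toLinearMap =
      Coalgebra.counit ∘ₗ (φ₂ ^ (-1 : ℤ)).toLinearMap := by
    rw [eα]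
    exact LinearMap.ext fun x => by simpa using (hφ.counit_snd_pow_neg 1 x).symm
  have eβ' : (β.comp (i : B →ₐ[k] H)).toLinearMap =
      Coalgebra.counit ∘ₗ (φ₂ ^ (- (-1) : ℤ)).toLinearMap := by
    rw [eβ, neg_neg, zpow_one]
  have a₁ : ∀ b, rightTranslate α (i b) = i (φ₁ b) := fun b => by
    rw [rightTranslate_bialgHom, eα, ← hφ.toConv_comp_fst]; rfl
  have a₂ : ∀ b, rightTranslate β (i b) = i (φ₁⁻¹ b) := fun b => by
    rw [rightTranslate_bialgHom, eβ', hφ.mul_counit_snd_zpow_neg, zpow_neg_one]; rfl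
  have b₁ : ∀ b, leftTranslate β (i b) = i (φ₂ b) := fun b => by
    rw [leftTranslate_bialgHom, eβ, ← hφ.toConv_comp_snd]; rfl
  have b₂ : ∀ b, leftTranslate α (i b) = i (φ₂⁻¹ b) := fun b => by
    rw [leftTranslate_bialgHom, eα', hφ.counit_snd_zpow_mul, zpow_neg_one]; rfl
  let Φ₁ : H ≃ₐ[k] H := AlgEquiv.ofAlgHom (rightTranslate α) (rightTranslate β)
    (hi.algHom_ext fun b => by
      rw [AlgHom.comp_apply, a₂, a₁]; exact congrArg i (φ₁.apply_symm_apply b))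
    (hi.algHom_ext fun b => by
      rw [AlgHom.comp_apply, a₁, a₂]; exact congrArg i (φ₁.symm_apply_apply b))
  let Φ₂ : H ≃ₐ[k] H := AlgEquiv.ofAlgHom (leftTranslate β) (leftTranslate α)
    (hi.algHom_ext fun b => by
      rw [AlgHom.comp_apply, b₂, b₁]; exact congrArg i (φ₂.apply_symm_apply b))
    (hi.algHom_ext fun b => by
      rw [AlgHom.comp_apply, b₁, b₂]; exact congrArg i (φ₂.symm_apply_apply b))
  have e₁ : ∀ b, Φ₁ (i b) = i (φ₁ b) := a₁
  have e₂ : ∀ b, Φ₂ (i b) = i (φ₂ b) := b₁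
  let I := (i : B →ₐ[k] H).toLinearMap
  have f₁ : Φ₁.toLinearMap ∘ₗ I = I ∘ₗ φ₁.toLinearMap := LinearMap.ext e₁
  have f₂ : Φ₂.toLinearMap ∘ₗ I = I ∘ₗ φ₂.toLinearMap := LinearMap.ext e₂
  -- The three axioms are equalities of algebra maps out of `H`, hence follow from those of `B` on
  -- `i(B)`.
  have c₁ : (Bialgebra.comulAlgHom k H).comp (Φ₁ : H →ₐ[k] H) =
      (Algebra.TensorProduct.map (.id k H) (Φ₁ : H →ₐ[k] H)).comp (Bialgebra.comulAlgHom k H) :=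
    hi.algHom_ext fun b => by
      have h1 : Coalgebra.comul (R := k) (φ₁ b) =
        TensorProduct.map LinearMap.id φ₁.toLinearMap (Coalgebra.comul b) :=
        LinearMap.congr_fun hφ.comul_fst b
      have h2 : TensorProduct.map I I ∘ₗ TensorProduct.map LinearMap.id φ₁.toLinearMap =
          TensorProduct.map LinearMap.id Φ₁.toLinearMap ∘ₗ TensorProduct.map I I := by
        rw [← TensorProduct.map_comp, ← TensorProduct.map_comp, f₁]; rfl
      refine (congrArg Coalgebra.comul (e₁ b)).trans ?_
      rw [comul_bialgHom, h1]
      refine (LinearMap.congr_fun h2 (Coalgebra.comul b)).trans ?_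
      exact congrArg (TensorProduct.map LinearMap.id Φ₁.toLinearMap) (comul_bialgHom i b).symm
  have c₂ : (Bialgebra.comulAlgHom k H).comp (Φ₂ : H →ₐ[k] H) =
      (Algebra.TensorProduct.map (Φ₂ : H →ₐ[k] H) (.id k H)).comp (Bialgebra.comulAlgHom k H) :=
    hi.algHom_ext fun b => by
      have h1 : Coalgebra.comul (R := k) (φ₂ b) =
        TensorProduct.map φ₂.toLinearMap LinearMap.id (Coalgebra.comul b) :=
        LinearMap.congr_fun hφ.comul_snd b
      have h2 : TensorProduct.map I I ∘ₗ TensorProduct.map φ₂.toLinearMap LinearMap.id =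
          TensorProduct.map Φ₂.toLinearMap LinearMap.id ∘ₗ TensorProduct.map I I := by
        rw [← TensorProduct.map_comp, ← TensorProduct.map_comp, f₂]; rfl
      refine (congrArg Coalgebra.comul (e₂ b)).trans ?_
      rw [comul_bialgHom, h1]
      refine (LinearMap.congr_fun h2 (Coalgebra.comul b)).trans ?_
      exact congrArg (TensorProduct.map Φ₂.toLinearMap LinearMap.id) (comul_bialgHom i b).symm
  have c₃ : ((Bialgebra.counitAlgHom k H).comp (Φ₁ : H →ₐ[k] H)).comp (Φ₂ : H →ₐ[k] H) =
      Bialgebra.counitAlgHom k H :=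
    hi.algHom_ext fun b => by
      refine (congrArg (fun x => Coalgebra.counit (R := k) (Φ₁ x)) (e₂ b)).trans ?_
      refine (congrArg (Coalgebra.counit (R := k)) (e₁ (φ₂ b))).trans ?_
      have h : ∀ b, Coalgebra.counit (R := k) (i b) = Coalgebra.counit (R := k) b :=
        CoalgHomClass.counit_comp_apply i
      exact (h _).trans ((hφ.counit_comp b).trans (h b).symm)
  exact ⟨Φ₁, Φ₂, ⟨LinearMap.ext fun x => AlgHom.congr_fun c₁ x,
    LinearMap.ext fun x => AlgHom.congr_fun c₂ x, fun x => AlgHom.congr_fun c₃ x⟩, e₁, e₂⟩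

/-- The coaction of the group algebra of `ℤ` on the Hopf envelope. -/
theorem exists_coaction {𝓑 : ℤ → Submodule k B} (h𝓑 : TwistingConditions 𝓑) :
    ∃ ρ : H →ₐc[k] AddMonoidAlgebra H ℤ, ∀ n, ∀ b ∈ 𝓑 n,
      ρ (i b) = AddMonoidAlgebra.single n (i b) := by
  let r : B →ₐ[k] AddMonoidAlgebra H ℤ := (AddMonoidAlgebra.mapAlgHom ℤ (i : B →ₐ[k] H)).comp
    (gradingCoaction 𝓑 h𝓑.gradedMonoid h𝓑.isInternal)
  have hr : ∀ n, ∀ b ∈ 𝓑 n, r b = AddMonoidAlgebra.single n (i b) := fun n b hb => by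
    simp [r, gradingCoaction_apply h𝓑.gradedMonoid h𝓑.isInternal hb,
      -LaurentPolynomial.single_eq_C_mul_T]
  have h1 : (Bialgebra.counitAlgHom k (AddMonoidAlgebra H ℤ)).comp r =
      Bialgebra.counitAlgHom k B :=
    AlgHom.toLinearMap_injective (homogeneous_ext h𝓑.isInternal fun n b hb => by
      refine (congrArg (Coalgebra.counit (R := k)) (hr n b hb)).trans ?_
      rw [AddMonoidAlgebra.counit_single]
      exact CoalgHomClass.counit_comp_apply i b)
  -- Here (T2) is essential: `Δ(b Tⁿ) = ∑ b₁ Tⁿ ⊗ b₂ Tⁿ` matches `∑ r(b₁) ⊗ r(b₂)` because both legs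
  -- of `Δ(b)` have degree `n`.
  have h2 : (Algebra.TensorProduct.map r r).comp (Bialgebra.comulAlgHom k B) =
      (Bialgebra.comulAlgHom k (AddMonoidAlgebra H ℤ)).comp r :=
    AlgHom.toLinearMap_injective (homogeneous_ext h𝓑.isInternal fun n b hb => by
      refine Eq.trans ?_ (congrArg (Coalgebra.comul (R := k)) (hr n b hb)).symm
      rw [AddMonoidAlgebra.comul_single, comul_bialgHom]
      obtain ⟨t, ht⟩ := h𝓑.comul_mem n b hb
      refine (congrArg (TensorProduct.map r.toLinearMap r.toLinearMap) ht.symm).trans ?_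
      rw [← ht]
      simp only [← LinearMap.comp_apply, ← TensorProduct.map_comp]
      have : r.toLinearMap ∘ₗ (𝓑 n).subtype = AddMonoidAlgebra.lsingle n ∘ₗ
          (i : B →ₐ[k] H).toLinearMap ∘ₗ (𝓑 n).subtype := LinearMap.ext fun x => hr n x x.2
      rw [this])
  obtain ⟨ρ, hρ, -⟩ := hi _ (BialgHom.ofAlgHom r h1 h2)
  exact ⟨ρ, fun n b hb => (DFunLike.congr_fun hρ b).trans (hr n b hb)⟩

end IsHopfEnvelope

/-! ### Degree arguments: twisting pairs and the antipode. -/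

namespace TwistingConditions

variable {k B M : Type*} [Field k] [Ring B] [Bialgebra k B] [AddCommGroup M] [Module k M]
  {𝓑 : ℤ → Submodule k B} (h : TwistingConditions 𝓑)
include h

/-- Linear maps that agree on `B_n ⊗ B_n` agree on `Δ(B_n)`. -/
theorem map_comul_congr {n : ℤ} {x : B} (hx : x ∈ 𝓑 n) {F G : B ⊗[k] B →ₗ[k] M}
    (hFG : ∀ a ∈ 𝓑 n, ∀ b ∈ 𝓑 n, F (a ⊗ₜ b) = G (a ⊗ₜ b)) :
    F (Coalgebra.comul x) = G (Coalgebra.comul x) := by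
  obtain ⟨t, ht⟩ := h.comul_mem n x hx
  rw [← ht, ← LinearMap.comp_apply, ← LinearMap.comp_apply]
  refine LinearMap.congr_fun (TensorProduct.ext' fun a b => ?_) t
  exact hFG a a.2 b b.2

/-- Modulo `N`, the map `F` agrees with `0` on `B_n ⊗ B_n`. -/
theorem map_comul_mem {n : ℤ} {x : B} (hx : x ∈ 𝓑 n) {F : B ⊗[k] B →ₗ[k] M} {N : Submodule k M}
    (hF : ∀ a ∈ 𝓑 n, ∀ b ∈ 𝓑 n, F (a ⊗ₜ b) ∈ N) : F (Coalgebra.comul x) ∈ N := by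
  rw [← Submodule.Quotient.mk_eq_zero, ← Submodule.mkQ_apply, ← LinearMap.comp_apply,
    h.map_comul_congr hx (F := N.mkQ ∘ₗ F) (G := 0), LinearMap.zero_apply]
  intro a ha b hb
  exact (Submodule.Quotient.mk_eq_zero N).2 (hF a ha b hb)

/-- A translation only takes linear combinations of the legs of `Δ(x)`, which have degree `n`;
twisting pairs are therefore automatically graded. -/
theorem fst_mem {φ₁ φ₂ : B ≃ₐ[k] B} (hφ : IsTwistingPair φ₁ φ₂) {n : ℤ} {x : B} (hx : x ∈ 𝓑 n) :
    φ₁ x ∈ 𝓑 n := by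
  have h1 := LinearMap.congr_fun (congrArg ofConv (hφ.toConv_comp_fst LinearMap.id)) x
  refine h1.symm ▸ ?_
  refine h.map_comul_mem hx (F := LinearMap.mul' k B ∘ₗ TensorProduct.map LinearMap.id
    (Algebra.linearMap k B ∘ₗ Coalgebra.counit ∘ₗ φ₁.toLinearMap)) fun a ha b _ => ?_
  simpa [← Algebra.commutes, ← Algebra.smul_def] using Submodule.smul_mem _ _ ha

theorem snd_mem {φ₁ φ₂ : B ≃ₐ[k] B} (hφ : IsTwistingPair φ₁ φ₂) {n : ℤ} {x : B} (hx : x ∈ 𝓑 n) :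
    φ₂ x ∈ 𝓑 n := by
  have h1 := LinearMap.congr_fun (congrArg ofConv (hφ.toConv_comp_snd LinearMap.id)) x
  refine h1.symm ▸ ?_
  refine h.map_comul_mem hx (F := LinearMap.mul' k B ∘ₗ TensorProduct.map
    (Algebra.linearMap k B ∘ₗ Coalgebra.counit ∘ₗ φ₂.toLinearMap) LinearMap.id) fun a _ b hb => ?_
  simpa [← Algebra.smul_def] using Submodule.smul_mem _ _ hb

end TwistingConditions

/-- The antipode maps `H_n` to `H_{-n}`. -/
theorem TwistingConditions.antipode_mem {k H : Type*} [Field k] [Ring H] [HopfAlgebra k H]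
    {𝓗 : ℤ → Submodule k H}
    (h𝓗 : TwistingConditions 𝓗) {n : ℤ} {x : H} (hx : x ∈ 𝓗 n) :
    HopfAlgebra.antipode k x ∈ 𝓗 (-n) := by
  let ρ := gradingCoaction 𝓗 h𝓗.gradedMonoid h𝓗.isInternal
  -- The candidate `x ↦ S(x) T^(-|x|)` is a right convolution inverse of `ρ`, while `ρ ∘ S` is a
  -- left one, so they coincide.
  let F : H →ₗ[k] AddMonoidAlgebra H ℤ := homogeneousLift 𝓗 h𝓗.isInternal fun n =>
    AddMonoidAlgebra.lsingle (-n) ∘ₗ HopfAlgebra.antipode k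
  have h1 : toConv (ρ.toLinearMap ∘ₗ HopfAlgebra.antipode k) * toConv ρ.toLinearMap = 1 := by
    have := LinearMap.algHom_comp_convMul_distrib ρ (toConv (HopfAlgebra.antipode k (A := H)))
      (toConv LinearMap.id)
    rw [LinearMap.antipode_mul_id] at this
    refine (congrArg toConv this).symm.trans (WithConv.ext (LinearMap.ext fun x => ?_))
    exact ρ.commutes _
  have h2 : toConv ρ.toLinearMap * toConv F = 1 := by
    refine WithConv.ext (homogeneous_ext h𝓗.isInternal fun n x hx => ?_)
    refine (h𝓗.map_comul_congr hx
      (F := LinearMap.mul' k _ ∘ₗ TensorProduct.map ρ.toLinearMap F)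
      (G := AddMonoidAlgebra.lsingle 0 ∘ₗ LinearMap.mul' k H ∘ₗ
        TensorProduct.map LinearMap.id (HopfAlgebra.antipode k)) fun a ha b hb => ?_).trans ?_
    · have e1 : ρ a = AddMonoidAlgebra.single n a := gradingCoaction_apply _ _ ha
      have e2 : F b = AddMonoidAlgebra.single (-n) (HopfAlgebra.antipode k b) :=
        homogeneousLift_apply h𝓗.isInternal _ hb
      simp [e1, e2, AddMonoidAlgebra.single_mul_single, -LaurentPolynomial.single_eq_C_mul_T]
    · refine (congrArg (AddMonoidAlgebra.lsingle 0)
        (LinearMap.congr_fun (congrArg ofConv (LinearMap.id_mul_antipode (R := k) (C := H))) x)).trans ?_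
      rfl
  have h3 := congrArg ofConv (left_inv_eq_right_inv h1 h2)
  rw [mem_iff_gradingCoaction h𝓗.gradedMonoid h𝓗.isInternal]
  exact (LinearMap.congr_fun h3 x).trans (homogeneousLift_apply h𝓗.isInternal _ hx)

/-! ### Existence and uniqueness of the grading on the Hopf envelope. -/

namespace IsHopfEnvelope

variable {k B H : Type u} [Field k] [Ring B] [Bialgebra k B] [Ring H] [HopfAlgebra k H]
  {i : B →ₐc[k] H} (hi : IsHopfEnvelope i) {𝓑 : ℤ → Submodule k B} (h𝓑 : TwistingConditions 𝓑)
include hi h𝓑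

theorem algHom_ext_homogeneous {A : Type*} [Ring A] [Algebra k A] {φ ψ : H →ₐ[k] A}
    (h : ∀ n, ∀ b ∈ 𝓑 n, φ (i b) = ψ (i b)) : φ = ψ :=
  hi.algHom_ext (homogeneous_induction h𝓑.isInternal h fun x y hx hy => by
    rw [map_add, map_add, map_add, hx, hy])

/-- The grading extends to the Hopf envelope. -/
theorem exists_twistingConditions :
    ∃ 𝓗 : ℤ → Submodule k H, TwistingConditions 𝓗 ∧ ∀ n, ∀ b ∈ 𝓑 n, i b ∈ 𝓗 n := by
  obtain ⟨ρ, hρ⟩ := hi.exists_coaction h𝓑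
  let r : H →ₐ[k] AddMonoidAlgebra H ℤ := ρ
  have hr : ∀ n, ∀ b ∈ 𝓑 n, r (i b) = AddMonoidAlgebra.single n (i b) := hρ
  -- This counit law and the coassociativity law `h2` compare algebra maps, so homogeneous elements
  -- of `B` suffice.
  have h1 : (sumCoeff k H).comp r = .id k H :=
    hi.algHom_ext_homogeneous h𝓑 fun n b hb => by
      rw [AlgHom.comp_apply, hr n b hb, sumCoeff_single, AlgHom.id_apply]
  have h2 : (AddMonoidAlgebra.mapAlgHom ℤ r).comp r = (diagCoeff k H).comp r :=
    hi.algHom_ext_homogeneous h𝓑 fun n b hb => by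
      rw [AlgHom.comp_apply, AlgHom.comp_apply, hr n b hb, AddMonoidAlgebra.mapAlgHom_single,
        hr n b hb, diagCoeff_single]
  have hmem : ∀ n x, (r x).coeff n ∈ coactionGrading r n := fun n x => by
    have := congrArg (fun y => y.coeff n) (AlgHom.congr_fun h2 x)
    simp only [AlgHom.comp_apply, AddMonoidAlgebra.coeff_mapAlgHom, coeff_diagCoeff] at this
    exact this
  refine ⟨coactionGrading r, ⟨coactionGrading_gradedMonoid r,
    coactionGrading_isInternal r (fun x => ?_) hmem, fun n x hx => ?_⟩, hr⟩
  · rw [← sumCoeff_apply (k := k)]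
    exact AlgHom.congr_fun h1 x
  -- The map `p` projects to degree `n`. Since `ρ` respects `Δ`, `∑ ρ(x₁) ⊗ ρ(x₂) = ∑ x₁ Tⁿ ⊗ x₂
  -- Tⁿ`; coefficients of `Tⁿ` in both legs give `(p ⊗ p)Δ(x) = Δ(x)`.
  · let p : H →ₗ[k] coactionGrading r n :=
      (coeffLinear k n ∘ₗ r.toLinearMap).codRestrict _ fun x => hmem n x
    refine ⟨TensorProduct.map p p (Coalgebra.comul x), ?_⟩
    have h3 : TensorProduct.map r.toLinearMap r.toLinearMap (Coalgebra.comul x) =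
        Coalgebra.comul (R := k) (r x) := CoalgHomClass.map_comp_comul_apply ρ x
    rw [mem_coactionGrading.1 hx, AddMonoidAlgebra.comul_single] at h3
    have h4 := congrArg (TensorProduct.map (coeffLinear k n) (coeffLinear k n)) h3
    have h5 : coeffLinear k n ∘ₗ AddMonoidAlgebra.lsingle n = (LinearMap.id : H →ₗ[k] H) := by
      ext x
      simp [coeffLinear_apply, -LaurentPolynomial.single_eq_C_mul_T]
    rw [TensorProduct.map_map, TensorProduct.map_map, h5, TensorProduct.map_id] at h4
    rw [TensorProduct.map_map]
    exact h4

/-- The two coactions are algebra maps that agree on `i(B)`, and a coaction determines its grading.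
-/
theorem twistingConditions_unique {𝓗 𝓗' : ℤ → Submodule k H} (h : TwistingConditions 𝓗)
    (h' : TwistingConditions 𝓗') (hb : ∀ n, ∀ b ∈ 𝓑 n, i b ∈ 𝓗 n)
    (hb' : ∀ n, ∀ b ∈ 𝓑 n, i b ∈ 𝓗' n) : 𝓗 = 𝓗' := by
  have : gradingCoaction 𝓗 h.gradedMonoid h.isInternal =
      gradingCoaction 𝓗' h'.gradedMonoid h'.isInternal :=
    hi.algHom_ext_homogeneous h𝓑 fun n b hbn => by
      rw [gradingCoaction_apply _ _ (hb n b hbn), gradingCoaction_apply _ _ (hb' n b hbn)]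
  funext n
  ext x
  rw [mem_iff_gradingCoaction h.gradedMonoid h.isInternal, this,
    ← mem_iff_gradingCoaction h'.gradedMonoid h'.isInternal]

end IsHopfEnvelope

theorem IsTwistingPair.zpow {k B : Type*} [Field k] [Ring B] [Bialgebra k B] {φ₁ φ₂ : B ≃ₐ[k] B}
    (h : IsTwistingPair φ₁ φ₂) (n : ℤ) : IsTwistingPair (φ₁ ^ n) (φ₂ ^ n) where
  comul_fst := h.comul_fst_zpow n
  comul_snd := h.comul_snd_zpow n
  counit_comp x := by
    rw [← AlgEquiv.mul_apply, ← h.commute.mul_zpow, h.counit_mul_pow]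

/-! ### Convolution on `H ⊗ H`, bidegree by bidegree. -/

section Tensor

variable {k H A M : Type*} [Field k] [Ring H] [HopfAlgebra k H] [Ring A] [Algebra k A]
  [AddCommGroup M] [Module k M] {𝓗 : ℤ → Submodule k H}

theorem homogeneous_ext₂ (h𝓗 : DirectSum.IsInternal 𝓗) {F G : H ⊗[k] H →ₗ[k] M}
    (h : ∀ n m, ∀ x ∈ 𝓗 n, ∀ y ∈ 𝓗 m, F (x ⊗ₜ y) = G (x ⊗ₜ y)) : F = G :=
  TensorProduct.ext (homogeneous_ext h𝓗 fun n x hx =>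
    homogeneous_ext h𝓗 fun m y hy => h n m x hx y hy)

namespace TwistingConditions

variable (h : TwistingConditions 𝓗)
include h

/-- Linear maps that agree on homogeneous tensors of bidegree `(n, m)` agree on
`Δ_{H ⊗ H}(H_n ⊗ H_m)`. -/
theorem map_comul_congr₂ {n m : ℤ} {x y : H} (hx : x ∈ 𝓗 n) (hy : y ∈ 𝓗 m)
    {F G : (H ⊗[k] H) ⊗[k] (H ⊗[k] H) →ₗ[k] M}
    (hFG : ∀ a ∈ 𝓗 n, ∀ b ∈ 𝓗 n, ∀ c ∈ 𝓗 m, ∀ d ∈ 𝓗 m,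
      F ((a ⊗ₜ c) ⊗ₜ (b ⊗ₜ d)) = G ((a ⊗ₜ c) ⊗ₜ (b ⊗ₜ d))) :
    F (Coalgebra.comul (x ⊗ₜ y)) = G (Coalgebra.comul (x ⊗ₜ y)) := by
  -- The comultiplication of `H ⊗ H` is `Δ(x) ⊗ Δ(y)` with the middle factors exchanged, so the
  -- one-variable statement applies to `x` and then to `y`.
  have h1 : ∀ F : (H ⊗[k] H) ⊗[k] (H ⊗[k] H) →ₗ[k] M, F (Coalgebra.comul (x ⊗ₜ y)) =
      (F ∘ₗ (TensorProduct.tensorTensorTensorComm k H H H H).toLinearMap)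
        (Coalgebra.comul x ⊗ₜ Coalgebra.comul y) := fun F => rfl
  rw [h1, h1]
  generalize hF' : F ∘ₗ (TensorProduct.tensorTensorTensorComm k H H H H).toLinearMap = F'
  generalize hG' : G ∘ₗ (TensorProduct.tensorTensorTensorComm k H H H H).toLinearMap = G'
  refine h.map_comul_congr hx
    (F := F' ∘ₗ (TensorProduct.mk k (H ⊗[k] H) (H ⊗[k] H)).flip (Coalgebra.comul y))
    (G := G' ∘ₗ (TensorProduct.mk k (H ⊗[k] H) (H ⊗[k] H)).flip (Coalgebra.comul y))
    fun a ha b hb => ?_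
  refine h.map_comul_congr hy (F := F' ∘ₗ TensorProduct.mk k (H ⊗[k] H) (H ⊗[k] H) (a ⊗ₜ b))
    (G := G' ∘ₗ TensorProduct.mk k (H ⊗[k] H) (H ⊗[k] H) (a ⊗ₜ b)) fun c hc d hd => ?_
  subst hF' hG'
  exact hFG a ha b hb c hc d hd

/-- Convolution products of maps that are products of functions of one variable. -/
theorem convMul_tmul {n m : ℤ} {x y : H} (hx : x ∈ 𝓗 n) (hy : y ∈ 𝓗 m)
    {σ τ : WithConv (H ⊗[k] H →ₗ[k] A)} (f g s t : WithConv (H →ₗ[k] A))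
    (hσ : ∀ a ∈ 𝓗 n, ∀ c ∈ 𝓗 m, σ.ofConv (a ⊗ₜ c) = f.ofConv a * s.ofConv c)
    (hτ : ∀ a ∈ 𝓗 n, ∀ c ∈ 𝓗 m, τ.ofConv (a ⊗ₜ c) = g.ofConv a * t.ofConv c)
    (hc : ∀ a c, Commute (s.ofConv c) (g.ofConv a)) :
    (σ * τ).ofConv (x ⊗ₜ y) = (f * g).ofConv x * (s * t).ofConv y := by
  refine (h.map_comul_congr₂ hx hy (F := LinearMap.mul' k A ∘ₗ TensorProduct.map σ.ofConv τ.ofConv)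
    (G := (LinearMap.mul' k A ∘ₗ TensorProduct.map
      (LinearMap.mul' k A ∘ₗ TensorProduct.map f.ofConv g.ofConv)
      (LinearMap.mul' k A ∘ₗ TensorProduct.map s.ofConv t.ofConv)) ∘ₗ
      (TensorProduct.tensorTensorTensorComm k H H H H).toLinearMap)
    fun a ha b hb c hc' d hd => ?_).trans ?_
  · simp only [LinearMap.comp_apply, TensorProduct.map_tmul, LinearMap.mul'_apply, hσ a ha c hc',
      hτ b hb d hd, LinearEquiv.coe_coe, TensorProduct.tensorTensorTensorComm_tmul]
    -- The exchange of the middle factors is where `s` and `g` have to commute.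
    rw [mul_assoc, ← mul_assoc (s.ofConv c), hc, mul_assoc, mul_assoc]
  · have : TensorProduct.tensorTensorTensorComm k H H H H (Coalgebra.comul (x ⊗ₜ[k] y)) =
        Coalgebra.comul x ⊗ₜ Coalgebra.comul y :=
      (TensorProduct.tensorTensorTensorComm k H H H H).symm_apply_apply _
    rw [LinearMap.comp_apply, LinearEquiv.coe_coe, this]
    rfl

end TwistingConditions

end Tensor

/-! ### The cocycle, its twist and the Zhang twist. -/

section Cocycle

variable {k H : Type*} [Field k] [Ring H] [HopfAlgebra k H] {𝓗 : ℤ → Submodule k H}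
  {Φ₁ Φ₂ : H ≃ₐ[k] H}

/-- The bilinear form `x ⊗ y ↦ ε(x) ε(Φ^{c(|x|)}(y))`. -/
noncomputable def gradedForm (h𝓗 : DirectSum.IsInternal 𝓗) (Φ : H ≃ₐ[k] H) (c : ℤ → ℤ) :
    H ⊗[k] H →ₗ[k] k :=
  TensorProduct.lift (homogeneousLift 𝓗 h𝓗 fun n =>
    LinearMap.toSpanSingleton k (H →ₗ[k] k) (Coalgebra.counit ∘ₗ (Φ ^ c n).toLinearMap) ∘ₗ
      Coalgebra.counit)

theorem gradedForm_apply (h𝓗 : DirectSum.IsInternal 𝓗) (Φ : H ≃ₐ[k] H) (c : ℤ → ℤ) {n : ℤ} {x : H}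
    (hx : x ∈ 𝓗 n) (y : H) : gradedForm h𝓗 Φ c (x ⊗ₜ y) =
      Coalgebra.counit (R := k) x * Coalgebra.counit (R := k) ((Φ ^ c n) y) := by
  rw [gradedForm, TensorProduct.lift.tmul, homogeneousLift_apply h𝓗 _ hx]
  rfl

/-- In first degree `n` the forms are `ε ⊗ (ε ∘ Φ₂^(c n))` and `ε ⊗ (ε ∘ Φ₂^(d n))`, whose exponents
add under convolution. The cases `id` and `Neg.neg` give `σ` and its inverse. -/
theorem gradedForm_mul (h𝓗 : TwistingConditions 𝓗) (hΦ : IsTwistingPair Φ₁ Φ₂) (c d : ℤ → ℤ)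
    (hcd : ∀ n, c n + d n = 0) :
    toConv (gradedForm h𝓗.isInternal Φ₂ c) * toConv (gradedForm h𝓗.isInternal Φ₂ d) = 1 := by
  refine WithConv.ext (homogeneous_ext₂ h𝓗.isInternal fun n m x hx y hy => ?_)
  refine (h𝓗.convMul_tmul hx hy 1 1
    (toConv (Coalgebra.counit ∘ₗ (Φ₂ ^ c n).toLinearMap))
    (toConv (Coalgebra.counit ∘ₗ (Φ₂ ^ d n).toLinearMap))
    (fun a ha b _ => gradedForm_apply h𝓗.isInternal Φ₂ c ha b)
    (fun a ha b _ => gradedForm_apply h𝓗.isInternal Φ₂ d ha b)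
    fun _ _ => Commute.all _ _).trans ?_
  rw [hΦ.counit_snd_zpow_add, hcd, zpow_zero, one_mul]
  exact mul_comm _ _

/-- The 2-cocycle `σ(x, y) = ε(x) ε(Φ₂^{|x|}(y))`. -/
noncomputable def twistCocycle (h𝓗 : TwistingConditions 𝓗) (hΦ : IsTwistingPair Φ₁ Φ₂) :
    (WithConv (H ⊗[k] H →ₗ[k] k))ˣ where
  val := toConv (gradedForm h𝓗.isInternal Φ₂ id)
  inv := toConv (gradedForm h𝓗.isInternal Φ₂ Neg.neg)
  val_inv := gradedForm_mul h𝓗 hΦ _ _ fun n => add_neg_cancel n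
  inv_val := gradedForm_mul h𝓗 hΦ _ _ fun n => neg_add_cancel n

theorem twistCocycle_apply (h𝓗 : TwistingConditions 𝓗) (hΦ : IsTwistingPair Φ₁ Φ₂) {n : ℤ} {x : H}
    (hx : x ∈ 𝓗 n) (y : H) : (twistCocycle h𝓗 hΦ).val.ofConv (x ⊗ₜ y) =
      Coalgebra.counit (R := k) x * Coalgebra.counit (R := k) ((Φ₂ ^ n) y) :=
  gradedForm_apply h𝓗.isInternal Φ₂ id hx y

/-- For `x` of degree `n` and `y` of degree `m`, both sides of the cocycle identity equal `ε(x)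
ε(Φ₂ⁿ(y)) ε(Φ₂ⁿ⁺ᵐ(z))`. -/
theorem isTwoCocycle_twistCocycle (h𝓗 : TwistingConditions 𝓗) (hΦ : IsTwistingPair Φ₁ Φ₂) :
    IsTwoCocycle (twistCocycle h𝓗 hΦ) where
  cocycle x y z := by
    set σ := (twistCocycle h𝓗 hΦ).val
    have hσ : ∀ n, ∀ x ∈ 𝓗 n, ∀ y, σ.ofConv (x ⊗ₜ y) =
        Coalgebra.counit (R := k) x * Coalgebra.counit (R := k) ((Φ₂ ^ n) y) :=
      fun n x hx y => twistCocycle_apply h𝓗 hΦ hx y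
    change (σ * toConv (σ.ofConv ∘ₗ (TensorProduct.mk k H H).flip z ∘ₗ LinearMap.mul' k H)).ofConv
      (x ⊗ₜ y) = (σ * toConv (σ.ofConv ∘ₗ TensorProduct.mk k H H x ∘ₗ LinearMap.mul' k H)).ofConv
      (y ⊗ₜ z)
    induction x using homogeneous_induction h𝓗.isInternal with
    | add x x' hx hx' =>
      simp only [map_add, LinearMap.add_comp, LinearMap.comp_add, toConv_add, mul_add, ofConv_add,
        LinearMap.add_apply, TensorProduct.add_tmul, hx, hx']
    | mem n x hx =>
      induction y using homogeneous_induction h𝓗.isInternal with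
      | add y y' hy hy' =>
        simp only [map_add, TensorProduct.add_tmul, TensorProduct.tmul_add, hy, hy']
      | mem m y hy =>
        induction z using homogeneous_induction h𝓗.isInternal with
        | add z z' hz hz' =>
          simp only [map_add, LinearMap.add_comp, LinearMap.comp_add, toConv_add, mul_add,
            ofConv_add, LinearMap.add_apply, TensorProduct.tmul_add, hz, hz']
        | mem l z hz =>
          -- On the left `σ(ab, z)` is `ε(a) ε(b)` times the constant `ε(Φ₂ⁿ⁺ᵐ(z))`, as `ab` has
          -- degree `n + m`. On the right `σ(x, ab)` splits because `ε ∘ Φ₂ⁿ` is multiplicative, and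
          -- the exponents `m` and `n` add in the variable `z`. The convolution unit `1` is `ε`.
          rw [h𝓗.convMul_tmul hx hy 1 1 (toConv (Coalgebra.counit ∘ₗ (Φ₂ ^ n).toLinearMap))
              (Coalgebra.counit (R := k) ((Φ₂ ^ (n + m)) z) • 1)
              (fun a ha b _ => hσ n a ha b)
              (fun a ha b hb => by
                refine (hσ (n + m) _ (h𝓗.gradedMonoid.mul_mem ha hb) z).trans ?_
                rw [Bialgebra.counit_mul, mul_assoc, mul_comm (Coalgebra.counit b)]
                rfl)
              fun _ _ => Commute.all _ _,
            h𝓗.convMul_tmul hy hz 1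
              (Coalgebra.counit (R := k) x • toConv (Coalgebra.counit ∘ₗ (Φ₂ ^ n).toLinearMap))
              (toConv (Coalgebra.counit ∘ₗ (Φ₂ ^ m).toLinearMap))
              (toConv (Coalgebra.counit ∘ₗ (Φ₂ ^ n).toLinearMap))
              (fun a ha b _ => hσ m a ha b)
              (fun a ha b hb => by
                refine (hσ n x hx (a * b)).trans ?_
                rw [map_mul, Bialgebra.counit_mul, ← mul_assoc]
                rfl)
              fun _ _ => Commute.all _ _,
            hΦ.counit_snd_zpow_add, one_mul, one_mul, mul_smul_comm, mul_one, add_comm m n]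
          change Coalgebra.counit (R := k) x * (Coalgebra.counit (R := k) ((Φ₂ ^ (n + m)) z) *
            Coalgebra.counit (R := k) ((Φ₂ ^ n) y)) = Coalgebra.counit (R := k) x *
            Coalgebra.counit (R := k) ((Φ₂ ^ n) y) * Coalgebra.counit (R := k) ((Φ₂ ^ (n + m)) z)
          ring
  apply_one x := by
    change (twistCocycle h𝓗 hΦ).val.ofConv (x ⊗ₜ 1) = Coalgebra.counit x
    induction x using homogeneous_induction h𝓗.isInternal with
    | add x x' hx hx' => rw [TensorProduct.add_tmul, map_add, map_add, hx, hx']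
    | mem n x hx => rw [twistCocycle_apply h𝓗 hΦ hx, map_one, Bialgebra.counit_one, mul_one]
  one_apply x := by
    refine (twistCocycle_apply h𝓗 hΦ h𝓗.gradedMonoid.one_mem x).trans ?_
    simp

/-- In the first variable all factors of `σ` are `ε` and disappear. In the second, `σ` contributes
`ε ∘ Φ₂ⁿ` on the left, giving `Φ₂ⁿ`, and `σ⁻¹` contributes `ε ∘ Φ₂⁻ⁿ` on the right, giving `Φ₁ⁿ`. -/
theorem cocycleTwistMul_twistCocycle (h𝓗 : TwistingConditions 𝓗) (hΦ : IsTwistingPair Φ₁ Φ₂) :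
    cocycleTwistMul (twistCocycle h𝓗 hΦ) = zhangTwistMul 𝓗 h𝓗.isInternal (Φ₁ * Φ₂) := by
  refine homogeneous_ext₂ h𝓗.isInternal fun n m x hx y hy => ?_
  rw [zhangTwistMul_apply _ _ _ n x y hx]
  have h1 : ∀ a ∈ 𝓗 n, ∀ b ∈ 𝓗 m,
      (toConv (Algebra.linearMap k H ∘ₗ (twistCocycle h𝓗 hΦ).val.ofConv) *
        toConv (LinearMap.mul' k H)).ofConv (a ⊗ₜ b) = a * (Φ₂ ^ n) b := fun a ha b hb => by
    rw [h𝓗.convMul_tmul ha hb (scalarConv H Coalgebra.counit) (toConv LinearMap.id)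
      (scalarConv H (Coalgebra.counit ∘ₗ (Φ₂ ^ n).toLinearMap)) (toConv LinearMap.id)
      (fun a ha b _ => by
        refine (congrArg (algebraMap k H) (twistCocycle_apply h𝓗 hΦ ha b)).trans ?_
        exact map_mul _ _ _)
      (fun a _ b _ => rfl) (fun a c => (scalarConv_commute _ _ _ _).symm),
      scalarConv_counit, one_mul, hΦ.counit_snd_zpow_mul]
    rfl
  refine (h𝓗.convMul_tmul hx hy (toConv LinearMap.id) (scalarConv H Coalgebra.counit)
      (toConv (Φ₂ ^ n).toLinearMap)
      (scalarConv H (Coalgebra.counit ∘ₗ (Φ₂ ^ (-n)).toLinearMap)) h1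
      (fun a ha b _ => by
        refine (congrArg (algebraMap k H) (gradedForm_apply h𝓗.isInternal Φ₂ Neg.neg ha b)).trans ?_
        exact map_mul _ _ _) (fun a c => scalarConv_commute _ _ _ _)).trans ?_
  rw [scalarConv_counit, mul_one, hΦ.mul_counit_snd_zpow_neg, hΦ.commute.mul_zpow,
    (hΦ.commute.zpow_zpow n n).eq]
  rfl

/-- Only three properties of `θ = Φ₁Φ₂` matter: its powers preserve the grading, the
comultiplication and the counit. -/
theorem isHopfProduct_zhangTwistMul (h𝓗 : TwistingConditions 𝓗) (hΦ : IsTwistingPair Φ₁ Φ₂) :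
    IsHopfProduct (zhangTwistMul 𝓗 h𝓗.isInternal (Φ₁ * Φ₂)) := by
  have hθ : ∀ (n m : ℤ) x, x ∈ 𝓗 m → ((Φ₁ * Φ₂) ^ n) x ∈ 𝓗 m := fun n m x hx => by
    rw [hΦ.commute.mul_zpow]
    exact h𝓗.fst_mem (hΦ.zpow n) (h𝓗.snd_mem (hΦ.zpow n) hx)
  have hΔ : ∀ (n : ℤ) x, Coalgebra.comul (R := k) (((Φ₁ * Φ₂) ^ n) x) =
      TensorProduct.map ((Φ₁ * Φ₂) ^ n).toLinearMap ((Φ₁ * Φ₂) ^ n).toLinearMap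
        (Coalgebra.comul x) := fun n x => by
    rw [hΦ.commute.mul_zpow]
    exact (hΦ.zpow n).comul_fst_snd x
  have hε := hΦ.counit_mul_pow
  generalize Φ₁ * Φ₂ = θ at *
  have hμ : ∀ n, ∀ x ∈ 𝓗 n, ∀ y, zhangTwistMul 𝓗 h𝓗.isInternal θ (x ⊗ₜ y) = x * (θ ^ n) y :=
    fun n x hx y => zhangTwistMul_apply 𝓗 h𝓗.isInternal θ n x y hx
  generalize zhangTwistMul 𝓗 h𝓗.isInternal θ = μ at *
  refine ⟨fun x y z => ?_, fun x => ?_, fun x => ?_, ?_, ?_, ?_⟩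
  · induction x using homogeneous_induction h𝓗.isInternal with
    | add x x' hx hx' => simp only [TensorProduct.add_tmul, map_add, hx, hx']
    | mem n x hx =>
      induction y using homogeneous_induction h𝓗.isInternal with
      | add y y' hy hy' => simp only [TensorProduct.add_tmul, TensorProduct.tmul_add, map_add, hy, hy']
      | mem m y hy =>
        -- Both bracketings give `x θⁿ(y) θⁿ⁺ᵐ(z)`, because `x θⁿ(y)` has degree `n + m`.
        rw [hμ n x hx, hμ m y hy, hμ n x hx, hμ (n + m) _ (h𝓗.gradedMonoid.mul_mem hx (hθ n m y hy)),
          map_mul, mul_assoc, zpow_add]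
        rfl
  · rw [hμ 0 1 h𝓗.gradedMonoid.one_mem, one_mul]; simp
  · induction x using homogeneous_induction h𝓗.isInternal with
    | add x x' hx hx' => simp only [TensorProduct.add_tmul, map_add, hx, hx']
    | mem n x hx => rw [hμ n x hx, map_one, mul_one]
  · refine homogeneous_ext₂ h𝓗.isInternal fun n m x hx y hy => ?_
    rw [LinearMap.comp_apply, hμ n x hx, Bialgebra.comul_mul, hΔ, ← LinearMap.mul'_apply (R := k)]
    have h1 := h𝓗.map_comul_congr₂ hx hy (F := TensorProduct.map μ μ)
      (G := LinearMap.mul' k (H ⊗[k] H) ∘ₗ TensorProduct.map LinearMap.id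
        (TensorProduct.map (θ ^ n).toLinearMap (θ ^ n).toLinearMap) ∘ₗ
          (TensorProduct.tensorTensorTensorComm k H H H H).toLinearMap)
      fun a ha b hb c _ d _ => by simp [hμ n a ha, hμ n b hb]
    refine Eq.trans ?_ h1.symm
    have : TensorProduct.tensorTensorTensorComm k H H H H (Coalgebra.comul (x ⊗ₜ[k] y)) =
        Coalgebra.comul x ⊗ₜ Coalgebra.comul y :=
      (TensorProduct.tensorTensorTensorComm k H H H H).symm_apply_apply _
    rw [LinearMap.comp_apply, LinearMap.comp_apply, LinearEquiv.coe_coe, this]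
    rfl
  · refine homogeneous_ext₂ h𝓗.isInternal fun n m x hx y hy => ?_
    rw [LinearMap.comp_apply, hμ n x hx, Bialgebra.counit_mul, hε]
    exact mul_comm _ _
  -- The twist `θ⁻ⁿ` cancels the `θⁿ` in `x₁ θⁿ(S(x₂))`. On the other side `S(x₁)` has degree `-n`,
  -- so `S(x₁)` times `x₂` is `θ⁻ⁿ` of the untwisted product.
  · let S : H →ₗ[k] H := homogeneousLift 𝓗 h𝓗.isInternal fun n =>
      (θ ^ (-n)).toLinearMap ∘ₗ HopfAlgebra.antipode k
    have hS : ∀ n, ∀ x ∈ 𝓗 n, S x = (θ ^ (-n)) (HopfAlgebra.antipode k x) := fun n x hx =>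
      homogeneousLift_apply h𝓗.isInternal _ hx
    refine ⟨S, homogeneous_ext h𝓗.isInternal fun n x hx => ?_,
      homogeneous_ext h𝓗.isInternal fun n x hx => ?_⟩
    · refine (h𝓗.map_comul_congr hx (F := μ ∘ₗ TensorProduct.map S LinearMap.id)
        (G := (θ ^ (-n)).toLinearMap ∘ₗ LinearMap.mul' k H ∘ₗ
          TensorProduct.map (HopfAlgebra.antipode k) LinearMap.id) fun a ha b _ => ?_).trans ?_
      · simp only [LinearMap.comp_apply, TensorProduct.map_tmul, hS n a ha, LinearMap.id_apply,
          LinearMap.mul'_apply, AlgEquiv.toLinearMap_apply, map_mul]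
        rw [hμ (-n) _ (hθ _ _ _ (h𝓗.antipode_mem ha))]
      · refine (congrArg (θ ^ (-n)) (HopfAlgebra.mul_antipode_rTensor_comul_apply x)).trans ?_
        exact AlgEquiv.commutes _ _
    · refine (h𝓗.map_comul_congr hx (F := μ ∘ₗ TensorProduct.map LinearMap.id S)
        (G := LinearMap.mul' k H ∘ₗ
          TensorProduct.map LinearMap.id (HopfAlgebra.antipode k)) fun a ha b hb => ?_).trans ?_
      · simp only [LinearMap.comp_apply, TensorProduct.map_tmul, hS n b hb, LinearMap.id_apply,
          LinearMap.mul'_apply, hμ n a ha]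
        rw [← AlgEquiv.mul_apply, ← zpow_add, add_neg_cancel]
        rfl
      · exact HopfAlgebra.mul_antipode_lTensor_comul_apply x

end Cocycle

/-- The bialgebra automorphism `φ₁ ∘ φ₂` of a twisting pair. -/
noncomputable def IsTwistingPair.bialgEquiv {k B : Type*} [Field k] [Ring B] [Bialgebra k B]
    {φ₁ φ₂ : B ≃ₐ[k] B} (h : IsTwistingPair φ₁ φ₂) : B ≃ₐc[k] B :=
  BialgEquiv.ofAlgEquiv (φ₁ * φ₂) (AlgHom.ext h.counit_comp)
    (AlgHom.ext fun x => (h.comul_fst_snd x).symm)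

theorem IsTwistingPair.bialgEquiv_apply {k B : Type*} [Field k] [Ring B] [Bialgebra k B]
    {φ₁ φ₂ : B ≃ₐ[k] B} (h : IsTwistingPair φ₁ φ₂) (x : B) : h.bialgEquiv x = φ₁ (φ₂ x) := rfl

end

/-! ### Assembly of the three statements. -/

theorem mainTheorem2 {k B H : Type u} [Field k] [Ring B] [Bialgebra k B]
    [Ring H] [HopfAlgebra k H] (i : B →ₐc[k] H) (hi : IsHopfEnvelope i)
    (𝓑 : ℤ → Submodule k B) (h𝓑 : TwistingConditions 𝓑)
    (φ₁ φ₂ : B ≃ₐ[k] B) (hφ : IsTwistingPair φ₁ φ₂) :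
    -- the unique extension of the twisting pair
    (∃! Φ : (H ≃ₐ[k] H) × (H ≃ₐ[k] H), IsTwistingPair Φ.1 Φ.2 ∧
      (∀ b, Φ.1 (i b) = i (φ₁ b)) ∧ ∀ b, Φ.2 (i b) = i (φ₂ b)) ∧
    -- the grading of the Hopf envelope
    (∃! 𝓗 : ℤ → Submodule k H, TwistingConditions 𝓗 ∧ ∀ n, ∀ b ∈ 𝓑 n, i b ∈ 𝓗 n) ∧
    -- the Hopf algebra automorphism induced by `φ₁ ∘ φ₂`
    (∃! Ψ : H ≃ₐc[k] H, ∀ b, Ψ (i b) = i (φ₁ (φ₂ b))) ∧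
    ∀ (Φ₁ Φ₂ : H ≃ₐ[k] H) (𝓗 : ℤ → Submodule k H) (Ψ : H ≃ₐc[k] H)
      (_ : IsTwistingPair Φ₁ Φ₂) (_ : ∀ b, Φ₁ (i b) = i (φ₁ b)) (_ : ∀ b, Φ₂ (i b) = i (φ₂ b))
      (h𝓗 : TwistingConditions 𝓗) (_ : ∀ n, ∀ b ∈ 𝓑 n, i b ∈ 𝓗 n)
      (_ : ∀ b, Ψ (i b) = i (φ₁ (φ₂ b))),
      (∀ x, Ψ x = Φ₁ (Φ₂ x)) ∧
      (∀ n, ∀ x ∈ 𝓗 n, Ψ x ∈ 𝓗 n) ∧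
      ∃ σ : (WithConv (H ⊗[k] H →ₗ[k] k))ˣ, IsTwoCocycle σ ∧
        (∀ n, ∀ x ∈ 𝓗 n, ∀ y, σ.val (x ⊗ₜ y) =
          Coalgebra.counit (R := k) x * Coalgebra.counit (R := k) ((Φ₂ ^ n) y)) ∧
        IsHopfProduct (cocycleTwistMul σ) ∧
        cocycleTwistMul σ = zhangTwistMul 𝓗 h𝓗.isInternal (Ψ : H ≃ₐ[k] H) := by
  obtain ⟨Φ₁, Φ₂, hΦ, h₁, h₂⟩ := hi.exists_isTwistingPair hφ
  obtain ⟨𝓗, h𝓗, hb⟩ := hi.exists_twistingConditions h𝓑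
  refine ⟨⟨(Φ₁, Φ₂), ⟨hΦ, h₁, h₂⟩, fun Φ' hΦ' => Prod.ext ?_ ?_⟩, ⟨𝓗, ⟨h𝓗, hb⟩, fun 𝓗' h' =>
    hi.twistingConditions_unique h𝓑 h'.1 h𝓗 h'.2 hb⟩, ⟨hΦ.bialgEquiv, fun b => ?_,
    fun Ψ hΨ => ?_⟩, ?_⟩
  · exact hi.algEquiv_ext fun b => (hΦ'.2.1 b).trans (h₁ b).symm
  · exact hi.algEquiv_ext fun b => (hΦ'.2.2 b).trans (h₂ b).symm
  · rw [hΦ.bialgEquiv_apply, h₂, h₁]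
  · have : (Ψ : H ≃ₐ[k] H) = Φ₁ * Φ₂ := hi.algEquiv_ext fun b => by
      rw [AlgEquiv.mul_apply, h₂, h₁]
      exact hΨ b
    exact DFunLike.ext _ _ fun x => AlgEquiv.congr_fun this x
  -- The remaining claims concern arbitrary data with the stated properties, so the witnesses
  -- constructed above are discarded.
  · clear! Φ₁ Φ₂ 𝓗
    intro Φ₁ Φ₂ 𝓗 Ψ hΦ h₁ h₂ h𝓗 _ hΨ
    have e : (Ψ : H ≃ₐ[k] H) = Φ₁ * Φ₂ := hi.algEquiv_ext fun b => by
      rw [AlgEquiv.mul_apply, h₂, h₁]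
      exact hΨ b
    have e' : ∀ x, Ψ x = Φ₁ (Φ₂ x) := AlgEquiv.congr_fun e
    have hσ := cocycleTwistMul_twistCocycle h𝓗 hΦ
    refine ⟨e', fun n x hx => ?_, twistCocycle h𝓗 hΦ, isTwoCocycle_twistCocycle h𝓗 hΦ,
      fun n x hx y => twistCocycle_apply h𝓗 hΦ hx y, ?_, ?_⟩
    · rw [e']
      exact h𝓗.fst_mem hΦ (h𝓗.snd_mem hΦ hx)
    · rw [hσ]
      exact isHopfProduct_zhangTwistMul h𝓗 hΦ
    · rw [hσ, e]
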